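/- Let $\ell^2$ be the complex Hilbert space of square-summable sequences indexed by $n=1,2,3,\dots$. For $\alpha>0$ let $K_\alpha$ be the bounded operator on $\ell^2$ with the matrix \[ K_\alpha=\left(\frac{(nm)^{-\frac12+\alpha}}{[\max(n,m)]^{2\alpha}}\right)_{n,m=1}^{\infty}. \] For every $\alpha>0$ the operator $K_\alpha$ has only finitely many eigenvalues (possibly none), all of them real and simple. Denote by $N(K_\alpha)$ their number, and enumerate the eigenvalues of $K_\alpha$, and likewise those of $\alpha K_\alpha$, in decreasing order: $\lambda_1(K_\alpha)>\lambda_2(K_\alpha)>\cdots>\lambda_{N(K_\alpha)}(K_\alpha)$. Then: (i) For every fixed $j\ge 1$, the function $\alpha\mapsto\lambda_j(\alpha K_\alpha)$ is strictly increasing on the set of all $\alpha>0$ with $N(K_\alpha)\ge j$. (ii) The function $\alpha\mapsto N(K_\alpha)$, $\alpha>0$, is non-decreasing and unbounded. (iii) For every fixed $j\ge1$, one has $N(K_\alpha)\ge j$ for all sufficiently large $\alpha$, and \[ \lambda_j(K_\alpha)=\frac1j+O\!\left(\frac1\alpha\right)\qquad\text{as }\alpha\to\infty . \] -/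

import Mathlib

open Set Filter Topology Asymptotics

/-- The kernel `k_α(x, y) = (xy)^(-1/2 + α) / max(x, y)^(2α)`, for `x, y > 0`. -/
noncomputable def hardyKernel (α x y : ℝ) : ℝ :=
  (x * y) ^ (-(1 / 2 : ℝ) + α) / (max x y) ^ (2 * α)

/-- The complex Hilbert space `ℓ²` of square-summable sequences indexed by `n = 1, 2, 3, …`. -/
abbrev EllTwo : Type := lp (fun _ : ℕ+ => ℂ) 2

namespace HardyMatrix

/-! ### Boundedness of the matrix, by a Schur test with the weights `n^(-1/2)` -/

theorem kernel_comm (α x y : ℝ) : hardyKernel α x y = hardyKernel α y x := by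
  simp only [hardyKernel, mul_comm, max_comm]

theorem kernel_nonneg {α x y : ℝ} (hx : 0 < x) (hy : 0 < y) : 0 ≤ hardyKernel α x y := by
  unfold hardyKernel; positivity

theorem exists_increment_bound {s : ℝ} (hs : s ≠ 0) :
    ∃ C : ℝ, 0 ≤ C ∧ ∀ m : ℝ, 1 ≤ m →
      m ^ (s - 1) ≤ C * (s * ((m + 1) ^ s - m ^ s)) := by
  refine ⟨max 1 (2 ^ (1 - s)) / (s * s), div_nonneg (by positivity) (mul_self_nonneg s), fun m hm => ?_⟩
  have hm0 : 0 < m := by linarith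
  obtain ⟨c, hc, hcs⟩ := exists_hasDerivAt_eq_slope (fun x : ℝ => x ^ s)
    (fun x : ℝ => s * x ^ (s - 1)) (show m < m + 1 by linarith)
    (fun x hx => (Real.continuousAt_rpow_const x s
      (Or.inl (by have := hx.1; linarith))).continuousWithinAt)
    (fun x hx => Real.hasDerivAt_rpow_const (Or.inl (by have := hx.1; linarith)))
  have h1 : (m + 1) ^ s - m ^ s = s * c ^ (s - 1) := by
    rw [hcs]; ring
  have hc0 : 0 < c := by linarith [hc.1]
  rw [h1, ← mul_assoc s s, ← mul_assoc, div_mul_cancel₀ _ (mul_ne_zero hs hs)]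
  rcases le_total 1 s with h | h
  · calc m ^ (s - 1) ≤ c ^ (s - 1) :=
          Real.rpow_le_rpow hm0.le hc.1.le (by linarith)
      _ ≤ _ := le_mul_of_one_le_left (by positivity) (le_max_left _ _)
  · calc m ^ (s - 1) = 2 ^ (1 - s) * (2 * m) ^ (s - 1) := by
          rw [Real.mul_rpow (by norm_num) hm0.le, ← mul_assoc, ← Real.rpow_add (by norm_num)]
          simp
      _ ≤ 2 ^ (1 - s) * c ^ (s - 1) := by
          gcongr ?_ * ?_
          exact Real.rpow_le_rpow_of_nonpos hc0 (by linarith [hc.2]) (by linarith)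
      _ ≤ _ := by gcongr; exact le_max_right _ _

theorem exists_lower_sum_bound {α : ℝ} (hα : 0 < α) :
    ∃ C : ℝ, 0 ≤ C ∧ ∀ n : ℕ, 1 ≤ n →
      ∑ m ∈ Finset.Ico 1 (n + 1), (m : ℝ) ^ (α - 1) ≤ C * (n : ℝ) ^ α := by
  obtain ⟨C, hC, h⟩ := exists_increment_bound hα.ne'
  refine ⟨C * α * 2 ^ α, by positivity, fun n hn => ?_⟩
  have hn1 : (1 : ℝ) ≤ n := by exact_mod_cast hn
  calc ∑ m ∈ Finset.Ico 1 (n + 1), (m : ℝ) ^ (α - 1)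
      ≤ ∑ m ∈ Finset.Ico 1 (n + 1), C * α * (((m + 1 : ℕ) : ℝ) ^ α - (m : ℝ) ^ α) := by
        refine Finset.sum_le_sum fun m hm => ?_
        have := h m (by exact_mod_cast (Finset.mem_Ico.1 hm).1)
        simpa [mul_assoc] using this
    _ = C * α * (((n + 1 : ℕ) : ℝ) ^ α - ((1 : ℕ) : ℝ) ^ α) := by
        rw [← Finset.mul_sum, Finset.sum_Ico_sub (fun m : ℕ => (m : ℝ) ^ α) (by omega)]
    _ ≤ C * α * (2 * n) ^ α := by
        gcongr
        refine (sub_le_self _ (by positivity)).trans ?_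
        refine Real.rpow_le_rpow (by positivity) ?_ hα.le
        push_cast; linarith
    _ = C * α * 2 ^ α * (n : ℝ) ^ α := by
        rw [Real.mul_rpow (by norm_num) (by positivity)]; ring

theorem exists_upper_sum_bound {α : ℝ} (hα : 0 < α) :
    ∃ C : ℝ, 0 ≤ C ∧ ∀ n N : ℕ, 1 ≤ n → n ≤ N →
      ∑ m ∈ Finset.Ico n N, (m : ℝ) ^ (-α - 1) ≤ C * (n : ℝ) ^ (-α) := by
  obtain ⟨C, hC, h⟩ := exists_increment_bound (s := -α) (by linarith)
  refine ⟨C * α, by positivity, fun n N hn hN => ?_⟩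
  calc ∑ m ∈ Finset.Ico n N, (m : ℝ) ^ (-α - 1)
      ≤ ∑ m ∈ Finset.Ico n N, -(C * α) * (((m + 1 : ℕ) : ℝ) ^ (-α) - (m : ℝ) ^ (-α)) := by
        refine Finset.sum_le_sum fun m hm => ?_
        have := h m (by exact_mod_cast hn.trans (Finset.mem_Ico.1 hm).1)
        refine this.trans (le_of_eq ?_)
        push_cast
        ring
    _ = C * α * ((n : ℝ) ^ (-α) - (N : ℝ) ^ (-α)) := by
        rw [← Finset.mul_sum, Finset.sum_Ico_sub (fun m : ℕ => (m : ℝ) ^ (-α)) hN]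
        ring
    _ ≤ C * α * (n : ℝ) ^ (-α) := by
        gcongr
        exact sub_le_self _ (by positivity)

theorem kernel_mul_of_le {α x y : ℝ} (hx : 0 < x) (hy : 0 < y) (h : y ≤ x) :
    hardyKernel α x y * y ^ (-(1 / 2) : ℝ) = x ^ (-(1 / 2) : ℝ) * x ^ (-α) * y ^ (α - 1) := by
  unfold hardyKernel
  rw [max_eq_left h, Real.mul_rpow hx.le hy.le, div_eq_mul_inv, ← Real.rpow_neg hx.le]
  calc _ = (x ^ (-(1 / 2) + α : ℝ) * x ^ (-(2 * α))) *
        (y ^ (-(1 / 2) + α : ℝ) * y ^ (-(1 / 2) : ℝ)) := by ring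
    _ = _ := by
      rw [← Real.rpow_add hx, ← Real.rpow_add hx, ← Real.rpow_add hy]
      congr 2 <;> ring

theorem kernel_mul_of_ge {α x y : ℝ} (hx : 0 < x) (hy : 0 < y) (h : x ≤ y) :
    hardyKernel α x y * y ^ (-(1 / 2) : ℝ) = x ^ (-(1 / 2) : ℝ) * x ^ α * y ^ (-α - 1) := by
  unfold hardyKernel
  rw [max_eq_right h, Real.mul_rpow hx.le hy.le, div_eq_mul_inv, ← Real.rpow_neg hy.le]
  calc _ = x ^ (-(1 / 2) + α : ℝ) *
        (y ^ (-(1 / 2) + α : ℝ) * y ^ (-(2 * α)) * y ^ (-(1 / 2) : ℝ)) := by ring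
    _ = _ := by
      rw [← Real.rpow_add hx, ← Real.rpow_add hy, ← Real.rpow_add hy]
      congr 2; ring

theorem exists_row_bound {α : ℝ} (hα : 0 < α) :
    ∃ C : ℝ, 0 ≤ C ∧ ∀ (n : ℕ+) (G : Finset ℕ+),
      ∑ m ∈ G, hardyKernel α (n : ℕ) (m : ℕ) * ((m : ℕ) : ℝ) ^ (-(1 / 2) : ℝ)
        ≤ C * ((n : ℕ) : ℝ) ^ (-(1 / 2) : ℝ) := by
  obtain ⟨C₁, hC₁, h₁⟩ := exists_lower_sum_bound hα
  obtain ⟨C₂, hC₂, h₂⟩ := exists_upper_sum_bound hα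
  refine ⟨C₁ + C₂, by positivity, fun n G => ?_⟩
  have hn : (0 : ℝ) < ((n : ℕ) : ℝ) := by exact_mod_cast n.pos
  set x : ℝ := ((n : ℕ) : ℝ) with hx
  let f : ℕ → ℝ := fun m => hardyKernel α x m * (m : ℝ) ^ (-(1 / 2) : ℝ)
  have hf : ∀ m : ℕ, 1 ≤ m → 0 ≤ f m := fun m hm =>
    mul_nonneg (kernel_nonneg hn (by exact_mod_cast hm)) (by positivity)
  obtain ⟨N, hN⟩ : ∃ N : ℕ, ∀ m ∈ G, (m : ℕ) < N :=
    ⟨G.sup (fun m => (m : ℕ)) + 1, fun m hm =>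
      Nat.lt_succ_of_le (Finset.le_sup (f := fun m : ℕ+ => (m : ℕ)) hm)⟩
  have hsub : ∑ m ∈ G, f m ≤
      ∑ m ∈ Finset.Ico 1 ((n : ℕ) + 1) ∪ Finset.Ico (n : ℕ) (N + n), f m := by
    have hmap : ∑ m ∈ G, f m =
        ∑ m ∈ G.map ⟨fun m : ℕ+ => (m : ℕ), PNat.coe_injective⟩, f m := by
      rw [Finset.sum_map]; rfl
    rw [hmap]
    refine Finset.sum_le_sum_of_subset_of_nonneg ?_ fun m hm _ => hf m ?_
    · intro m hm
      simp only [Finset.mem_map, Function.Embedding.coeFn_mk] at hm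
      obtain ⟨k, hk, rfl⟩ := hm
      have h1 := hN k hk
      have h2 := k.pos
      simp only [Finset.mem_union, Finset.mem_Ico]
      omega
    · have h2 := n.pos
      simp only [Finset.mem_union, Finset.mem_Ico] at hm
      omega
  refine hsub.trans ?_
  have hun : ∑ m ∈ Finset.Ico 1 ((n : ℕ) + 1) ∪ Finset.Ico (n : ℕ) (N + n), f m ≤
      ∑ m ∈ Finset.Ico 1 ((n : ℕ) + 1), f m + ∑ m ∈ Finset.Ico (n : ℕ) (N + n), f m := by
    rw [← Finset.sum_union_inter]
    refine le_add_of_nonneg_right (Finset.sum_nonneg fun m hm => hf m ?_)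
    simp only [Finset.mem_inter, Finset.mem_Ico] at hm
    omega
  refine hun.trans ?_
  have e₁ : ∑ m ∈ Finset.Ico 1 ((n : ℕ) + 1), f m ≤ C₁ * x ^ (-(1 / 2) : ℝ) := by
    calc ∑ m ∈ Finset.Ico 1 ((n : ℕ) + 1), f m
        = x ^ (-(1 / 2) : ℝ) * x ^ (-α) *
            ∑ m ∈ Finset.Ico 1 ((n : ℕ) + 1), (m : ℝ) ^ (α - 1) := by
          rw [Finset.mul_sum]
          refine Finset.sum_congr rfl fun m hm => ?_
          have hm' := Finset.mem_Ico.1 hm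
          exact kernel_mul_of_le hn (by exact_mod_cast hm'.1)
            (by rw [hx]; exact_mod_cast Nat.le_of_lt_succ hm'.2)
      _ ≤ x ^ (-(1 / 2) : ℝ) * x ^ (-α) * (C₁ * x ^ α) := by
          gcongr
          exact h₁ n n.pos
      _ = C₁ * x ^ (-(1 / 2) : ℝ) * (x ^ (-α) * x ^ α) := by ring
      _ = C₁ * x ^ (-(1 / 2) : ℝ) := by rw [← Real.rpow_add hn]; simp
  have e₂ : ∑ m ∈ Finset.Ico (n : ℕ) (N + n), f m ≤ C₂ * x ^ (-(1 / 2) : ℝ) := by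
    calc ∑ m ∈ Finset.Ico (n : ℕ) (N + n), f m
        = x ^ (-(1 / 2) : ℝ) * x ^ α *
            ∑ m ∈ Finset.Ico (n : ℕ) (N + n), (m : ℝ) ^ (-α - 1) := by
          rw [Finset.mul_sum]
          refine Finset.sum_congr rfl fun m hm => ?_
          have hm' := Finset.mem_Ico.1 hm
          have hxm : x ≤ (m : ℝ) := by rw [hx]; exact_mod_cast hm'.1
          exact kernel_mul_of_ge hn (hn.trans_le hxm) hxm
      _ ≤ x ^ (-(1 / 2) : ℝ) * x ^ α * (C₂ * x ^ (-α)) := by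
          gcongr
          exact h₂ n _ n.pos (by omega)
      _ = C₂ * x ^ (-(1 / 2) : ℝ) * (x ^ α * x ^ (-α)) := by ring
      _ = C₂ * x ^ (-(1 / 2) : ℝ) := by rw [← Real.rpow_add hn]; simp
  linarith

theorem exists_schur_bound {α : ℝ} (hα : 0 < α) :
    ∃ C : ℝ, 0 ≤ C ∧ ∀ (x : EllTwo) (F G : Finset ℕ+),
      ∑ n ∈ F, (∑ m ∈ G, hardyKernel α (n : ℕ) (m : ℕ) * ‖x m‖) ^ 2 ≤ (C * ‖x‖) ^ 2 := by
  obtain ⟨C, hC, h⟩ := exists_row_bound hα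
  refine ⟨C, hC, fun x F G => ?_⟩
  let p : ℕ+ → ℝ := fun m => ((m : ℕ) : ℝ) ^ (-(1 / 2) : ℝ)
  have hpos : ∀ m : ℕ+, (0 : ℝ) < ((m : ℕ) : ℝ) := fun m => by exact_mod_cast m.pos
  have hp : ∀ m, 0 < p m := fun m => Real.rpow_pos_of_pos (hpos m) _
  let k : ℕ+ → ℕ+ → ℝ := fun n m => hardyKernel α (n : ℕ) (m : ℕ)
  have hk : ∀ n m, 0 ≤ k n m := fun n m => kernel_nonneg (hpos n) (hpos m)
  have hrow : ∀ n (G : Finset ℕ+), ∑ m ∈ G, k n m * p m ≤ C * p n := h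
  have hx : ∑ m ∈ G, ‖x m‖ ^ 2 ≤ ‖x‖ ^ 2 := by
    simpa using lp.sum_rpow_le_norm_rpow (p := 2) (by norm_num) x G
  calc ∑ n ∈ F, (∑ m ∈ G, k n m * ‖x m‖) ^ 2
      ≤ ∑ n ∈ F, (C * p n) * ∑ m ∈ G, k n m * (‖x m‖ ^ 2 / p m) := by
        refine Finset.sum_le_sum fun n _ => ?_
        have hcs : (∑ m ∈ G, k n m * ‖x m‖) ^ 2 ≤
            (∑ m ∈ G, k n m * p m) * ∑ m ∈ G, k n m * (‖x m‖ ^ 2 / p m) := by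
          refine Finset.sum_sq_le_sum_mul_sum_of_sq_le_mul G
            (fun m _ => mul_nonneg (hk n m) (hp m).le)
            (fun m _ => mul_nonneg (hk n m) (div_nonneg (sq_nonneg _) (hp m).le))
            fun m _ => ?_
          have := (hp m).ne'
          refine le_of_eq ?_
          field_simp
        refine hcs.trans (mul_le_mul_of_nonneg_right (hrow n G) ?_)
        exact Finset.sum_nonneg fun m _ =>
          mul_nonneg (hk n m) (div_nonneg (sq_nonneg _) (hp m).le)
    _ = ∑ m ∈ G, C * (‖x m‖ ^ 2 / p m) * ∑ n ∈ F, k m n * p n := by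
        simp only [Finset.mul_sum]
        rw [Finset.sum_comm]
        refine Finset.sum_congr rfl fun m _ => Finset.sum_congr rfl fun n _ => ?_
        have : k n m = k m n := kernel_comm _ _ _
        rw [this]; ring
    _ ≤ ∑ m ∈ G, C * (‖x m‖ ^ 2 / p m) * (C * p m) := by
        refine Finset.sum_le_sum fun m _ => mul_le_mul_of_nonneg_left (hrow m F) ?_
        exact mul_nonneg hC (div_nonneg (sq_nonneg _) (hp m).le)
    _ = C ^ 2 * ∑ m ∈ G, ‖x m‖ ^ 2 := by
        rw [Finset.mul_sum]
        refine Finset.sum_congr rfl fun m _ => ?_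
        have := (hp m).ne'
        field_simp
    _ ≤ (C * ‖x‖) ^ 2 := by
        rw [mul_pow]; gcongr

/-- The `n`-th entry of the matrix-vector product, `∑ₘ k_α(n, m) x(m)`. -/
noncomputable def row (α : ℝ) (x : ℕ+ → ℂ) (n : ℕ+) : ℂ :=
  ∑' m : ℕ+, (hardyKernel α (n : ℕ) (m : ℕ) : ℂ) * x m

theorem norm_entry {α : ℝ} (x : ℕ+ → ℂ) (n m : ℕ+) :
    ‖(hardyKernel α (n : ℕ) (m : ℕ) : ℂ) * x m‖ = hardyKernel α (n : ℕ) (m : ℕ) * ‖x m‖ := by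
  rw [norm_mul, Complex.norm_real, Real.norm_of_nonneg (kernel_nonneg
    (by exact_mod_cast n.pos) (by exact_mod_cast m.pos))]

/-- For `x ∈ ℓ²` the series defining each entry of the matrix-vector product converges
absolutely. -/
theorem summable_norm_entry {α : ℝ} (hα : 0 < α) (x : EllTwo) (n : ℕ+) :
    Summable fun m : ℕ+ => ‖(hardyKernel α (n : ℕ) (m : ℕ) : ℂ) * x m‖ := by
  obtain ⟨C, hC, h⟩ := exists_schur_bound hα
  refine summable_of_sum_le (c := C * ‖x‖) (fun _ => norm_nonneg _) fun G => ?_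
  have := h x {n} G
  rw [Finset.sum_singleton] at this
  simp only [norm_entry]
  exact le_of_sq_le_sq this (by positivity)

theorem exists_row_norm_bound {α : ℝ} (hα : 0 < α) :
    ∃ C : ℝ, 0 ≤ C ∧ ∀ (x : EllTwo) (F : Finset ℕ+),
      ∑ n ∈ F, ‖row α x n‖ ^ 2 ≤ (C * ‖x‖) ^ 2 := by
  obtain ⟨C, hC, h⟩ := exists_schur_bound hα
  refine ⟨C, hC, fun x F => ?_⟩
  have hlim : Tendsto (fun G : Finset ℕ+ => ∑ n ∈ F,
      ‖∑ m ∈ G, (hardyKernel α (n : ℕ) (m : ℕ) : ℂ) * x m‖ ^ 2) atTop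
      (𝓝 (∑ n ∈ F, ‖row α x n‖ ^ 2)) :=
    tendsto_finsetSum _ fun n _ =>
      ((summable_norm_entry hα x n).of_norm.hasSum.norm).pow 2
  refine le_of_tendsto' hlim fun G => (Finset.sum_le_sum fun n _ => ?_).trans (h x F G)
  gcongr
  refine (norm_sum_le _ _).trans (le_of_eq ?_)
  simp only [norm_entry]

theorem memℓp_row {α : ℝ} (hα : 0 < α) (x : EllTwo) : Memℓp (row α x) 2 := by
  obtain ⟨C, -, h⟩ := exists_row_norm_bound hα
  exact memℓp_gen' (C := (C * ‖x‖) ^ 2) fun F => by simpa using h x F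

/-- The linear map `x ↦ (∑ₘ k_α(n, m) x(m))ₙ` on `ℓ²`, for `α > 0`. -/
noncomputable def linearMap (α : ℝ) (hα : 0 < α) : EllTwo →ₗ[ℂ] EllTwo where
  toFun x := ⟨row α x, memℓp_row hα x⟩
  map_add' x y := by
    ext n
    change row α (⇑(x + y)) n = row α x n + row α y n
    simp only [row, lp.coeFn_add, Pi.add_apply, mul_add]
    exact (summable_norm_entry hα x n).of_norm.tsum_add (summable_norm_entry hα y n).of_norm
  map_smul' c x := by
    ext n
    change row α (⇑(c • x)) n = c * row α x n
    simp only [row, lp.coeFn_smul, Pi.smul_apply, smul_eq_mul, mul_left_comm _ c]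
    exact tsum_mul_left

theorem linearMap_bound {α : ℝ} (hα : 0 < α) :
    ∃ C : ℝ, ∀ x, ‖linearMap α hα x‖ ≤ C * ‖x‖ := by
  obtain ⟨C, hC, h⟩ := exists_row_norm_bound hα
  refine ⟨C, fun x => lp.norm_le_of_forall_sum_le (by norm_num) (by positivity) fun F => ?_⟩
  have h' : ∑ n ∈ F, ‖linearMap α hα x n‖ ^ 2 ≤ (C * ‖x‖) ^ 2 := h x F
  simpa using h'

end HardyMatrix

open Classical in
/-- The bounded operator `K_α` on `ℓ²` with the matrix `(k_α(n, m))`, `n, m ≥ 1`, for `α > 0`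
(and `0` for the irrelevant values `α ≤ 0`). -/
noncomputable def hardyOp (α : ℝ) : EllTwo →L[ℂ] EllTwo :=
  if hα : 0 < α then
    (HardyMatrix.linearMap α hα).mkContinuousOfExistsBound (HardyMatrix.linearMap_bound hα)
  else 0

theorem hardyOp_apply {α : ℝ} (hα : 0 < α) (x : EllTwo) (n : ℕ+) :
    hardyOp α x n = ∑' m : ℕ+, (hardyKernel α (n : ℕ) (m : ℕ) : ℂ) * x m := by
  rw [hardyOp, dif_pos hα]; rfl

/-- The set of real eigenvalues of a bounded operator on `ℓ²`. It is used for the self-adjoint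
operators `K_α` and `α K_α`, whose eigenvalues are all real. -/
def eigenvalueSet (T : EllTwo →L[ℂ] EllTwo) : Set ℝ :=
  {μ : ℝ | Module.End.HasEigenvalue (T : Module.End ℂ EllTwo) (μ : ℂ)}

/-- `N(T)`, the number of eigenvalues of `T`. -/
noncomputable def eigenvalueCount (T : EllTwo →L[ℂ] EllTwo) : ℕ :=
  (eigenvalueSet T).ncard

open Classical in
/-- `λ_j(T)` for `1 ≤ j ≤ N(T)`: the `j`-th entry of the list of the eigenvalues of `T` in
decreasing order `λ₁(T) > λ₂(T) > ⋯ > λ_{N(T)}(T)`; it is used only when the set of eigenvalues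
is finite and `1 ≤ j ≤ N(T)` (the value is `0` otherwise). -/
noncomputable def nthEigenvalue (T : EllTwo →L[ℂ] EllTwo) (j : ℕ) : ℝ :=
  if h : (eigenvalueSet T).Finite ∧ 1 ≤ j then
    (h.1.toFinset.sort (fun a b => b ≤ a)).getD (j - 1) 0
  else 0

/-! With t_n = log n the matrix is (nm)^(-1/2) exp(-α|t_n - t_m|). The Fourier transform of α
exp(-α|t|) is 2α²/(α² + ξ²), which grows with α and stays below 2. This suggests that the form of
αK_α is strictly increasing in α and that the essential spectrum of αK_α lies at or below 2. Once
every eigenvalue of αK_α is known to be simple and strictly above 2, and their number to be finite,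
the min-max principle turns the growth of the form into growth of each λ_j and of N. Moreover K_α
differs from diag(1/n) by an operator whose form is at most (2/α)‖x‖², which yields the asymptotics
and the unboundedness of N.

The proof works directly with sequences. The kernel (min/max)^α is multiplicative, so the lower
triangular sums P_n obey a one-step recursion, and the truncated form of K_α is a sum of squares of
the P_n (`realForm_eq_sum_sq`). Comparing the recursions for α < β through a quadratic storage
function writes the difference of the two forms as a sum of nonnegative dissipations
(`realForm_sub_eq`), which gives `quadForm_hardyOp_strictMono`.

For an eigenvector with eigenvalue λ, the pair z_n = √n (Kx)_n, D_n = z_n - 2P_n follows, up to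
errors O(n⁻²), the system z' = αD, D' = -(2/λ - α)z in the time log n. If 0 < λ ≤ 2/α its solutions
oscillate or grow at most linearly, and none except zero is square-summable with the weight 1/n;
hence λ > 2/α (`two_div_lt_of_mem_eigenvalueSet`). Finiteness follows from a Hardy-type inequality:
on a subspace of finite codimension ⟨Kx, x⟩ ≥ (α/2)‖Kx‖², whereas the opposite strict inequality
holds for nonzero combinations of eigenvectors with eigenvalues above 2/α. -/

namespace HardyMatrix

/-! ### Variational principle above the essential spectrum -/

section Variational

variable {H : Type*} [NormedAddCommGroup H] [InnerProductSpace ℂ H]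

/-- The quadratic form `x ↦ Re ⟨T x, x⟩` of a bounded operator. -/
noncomputable def quadForm (T : H →L[ℂ] H) (x : H) : ℝ := (inner ℂ (T x) x).re

theorem quadForm_smul_self {T : H →L[ℂ] H} {x : H} {μ : ℝ} (h : T x = (μ : ℂ) • x) :
    quadForm T x = μ * ‖x‖ ^ 2 := by
  rw [quadForm, h, inner_smul_left, Complex.conj_ofReal, Complex.re_ofReal_mul,
    ← inner_self_eq_norm_sq (𝕜 := ℂ) x]
  rfl

theorem quadForm_le (T : H →L[ℂ] H) (x : H) : quadForm T x ≤ ‖T‖ * ‖x‖ ^ 2 := by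
  calc quadForm T x ≤ ‖inner ℂ (T x) x‖ := Complex.re_le_norm _
    _ ≤ ‖T x‖ * ‖x‖ := norm_inner_le_norm _ _
    _ ≤ ‖T‖ * ‖x‖ * ‖x‖ := by gcongr; exact T.le_opNorm x
    _ = _ := by ring

theorem continuous_quadForm (T : H →L[ℂ] H) : Continuous (quadForm T) := by
  unfold quadForm
  fun_prop

theorem quadForm_real_smul (T : H →L[ℂ] H) (s : ℝ) (x : H) :
    quadForm T ((s : ℂ) • x) = s ^ 2 * quadForm T x := by
  rw [quadForm, map_smul, inner_smul_left, inner_smul_right, Complex.conj_ofReal, ← mul_assoc,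
    ← Complex.ofReal_mul, Complex.re_ofReal_mul, quadForm]
  ring

/-- A symmetric operator whose form is nonnegative on an invariant subspace `W` satisfies
`‖B x‖² ≤ (‖B‖ + 1) ⟨B x, x⟩` on `W`. -/
theorem norm_sq_le_quadForm {B : H →L[ℂ] H} (hB : (B : H →ₗ[ℂ] H).IsSymmetric)
    {W : Submodule ℂ H} (hW : ∀ x ∈ W, B x ∈ W) (hpos : ∀ x ∈ W, 0 ≤ quadForm B x)
    {x : H} (hx : x ∈ W) : ‖B x‖ ^ 2 ≤ (‖B‖ + 1) * quadForm B x := by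
  set C := ‖B‖ + 1 with hC
  have hC0 : 0 < C := by positivity
  -- This is the discriminant argument for Cauchy–Schwarz with the parameter 1/C fixed beforehand;
  -- the `+ 1` in C avoids dividing by ‖B‖ = 0.
  have h := hpos (x - ((1 / C : ℝ) : ℂ) • B x) (W.sub_mem hx (W.smul_mem _ (hW x hx)))
  have hsym : inner ℂ (B (B x)) x = inner ℂ (B x) (B x) := hB (B x) x
  have hself : (inner ℂ (B x) (B x)).re = ‖B x‖ ^ 2 := inner_self_eq_norm_sq (𝕜 := ℂ) (B x)
  have hexp : quadForm B (x - ((1 / C : ℝ) : ℂ) • B x) =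
      quadForm B x - 2 * (1 / C) * ‖B x‖ ^ 2 + (1 / C) ^ 2 * quadForm B (B x) := by
    simp only [quadForm, map_sub, map_smul, inner_sub_left, inner_sub_right, inner_smul_left,
      inner_smul_right, Complex.conj_ofReal, Complex.sub_re, Complex.re_ofReal_mul, hsym, hself]
    ring
  have hle : quadForm B (B x) ≤ C * ‖B x‖ ^ 2 :=
    (quadForm_le B _).trans (by gcongr; linarith)
  rw [hexp] at h
  have h2 : (1 / C) ^ 2 * quadForm B (B x) ≤ (1 / C) * ‖B x‖ ^ 2 := by
    calc (1 / C) ^ 2 * quadForm B (B x) ≤ (1 / C) ^ 2 * (C * ‖B x‖ ^ 2) := by gcongr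
      _ = _ := by field_simp
  have h3 : (1 / C) * ‖B x‖ ^ 2 ≤ quadForm B x := by linarith
  rw [one_div, inv_mul_le_iff₀ hC0] at h3
  exact h3

/-- `c` bounds the essential spectrum of `T` from above: for every `M > c`, the form of `T` is
at most `c' ‖x‖²`, with `c' < M`, on the orthogonal complement of a finite-dimensional space. -/
def EssentiallyBounded (T : H →L[ℂ] H) (c : ℝ) : Prop :=
  ∀ M > c, ∃ F : Submodule ℂ H, FiniteDimensional ℂ F ∧
    ∃ c' < M, ∀ x ∈ Fᗮ, quadForm T x ≤ c' * ‖x‖ ^ 2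

/-- Above the essential spectrum, the supremum of the Rayleigh quotient on the orthogonal
complement of an invariant subspace is an eigenvalue. -/
theorem exists_eigenvector_orthogonal [CompleteSpace H] {T : H →L[ℂ] H}
    (hT : (T : H →ₗ[ℂ] H).IsSymmetric) {c : ℝ} (hess : EssentiallyBounded T c)
    {E : Submodule ℂ H} (hE : ∀ x ∈ E, T x ∈ E) {b : ℝ} (hb : c ≤ b) {x₀ : H} (hx₀ : x₀ ∈ Eᗮ)
    (h : b * ‖x₀‖ ^ 2 < quadForm T x₀) :
    ∃ M > b, ∃ v ∈ Eᗮ, v ≠ 0 ∧ T v = (M : ℂ) • v := by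
  have hE' : ∀ x ∈ Eᗮ, T x ∈ Eᗮ := fun x hx => by
    rw [Submodule.mem_orthogonal] at hx ⊢
    intro u hu
    have := hT u x
    simp only [ContinuousLinearMap.coe_coe] at this
    rw [← this]
    exact hx _ (hE u hu)
  let S : Set ℝ := quadForm T '' {x | x ∈ Eᗮ ∧ ‖x‖ = 1}
  have hSb : BddAbove S := by
    refine ⟨‖T‖, ?_⟩
    rintro _ ⟨x, ⟨-, hx⟩, rfl⟩
    simpa [hx] using quadForm_le T x
  have hx₀0 : x₀ ≠ 0 := by
    rintro rfl
    simp [quadForm] at h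
  have hn0 : 0 < ‖x₀‖ := norm_pos_iff.2 hx₀0
  have hunit : ∀ x ∈ Eᗮ, x ≠ 0 → quadForm T x / ‖x‖ ^ 2 ∈ S := fun x hx hx0 => by
    have hn : 0 < ‖x‖ := norm_pos_iff.2 hx0
    refine ⟨((‖x‖⁻¹ : ℝ) : ℂ) • x, ⟨Submodule.smul_mem _ _ hx, ?_⟩, ?_⟩
    · rw [norm_smul, Complex.norm_real, norm_inv, norm_norm, inv_mul_cancel₀ hn.ne']
    · rw [quadForm_real_smul, inv_pow]
      field_simp
  set M := sSup S with hM
  have hMb : b < M := by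
    refine lt_of_lt_of_le ?_ (le_csSup hSb (hunit x₀ hx₀ hx₀0))
    rwa [lt_div_iff₀ (by positivity)]
  have hle : ∀ x ∈ Eᗮ, quadForm T x ≤ M * ‖x‖ ^ 2 := fun x hx => by
    rcases eq_or_ne x 0 with rfl | hx0
    · simp [quadForm]
    · have hn : 0 < ‖x‖ := norm_pos_iff.2 hx0
      have := le_csSup hSb (hunit x hx hx0)
      rwa [div_le_iff₀ (by positivity)] at this
  obtain ⟨F, hF, c', hc', hFc⟩ := hess M (lt_of_le_of_lt hb hMb)
  let B : H →L[ℂ] H := (M : ℂ) • ContinuousLinearMap.id ℂ H - T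
  have hBapp : ∀ x, B x = (M : ℂ) • x - T x := fun x => rfl
  have hBform : ∀ x, quadForm B x = M * ‖x‖ ^ 2 - quadForm T x := fun x => by
    rw [← inner_self_eq_norm_sq (𝕜 := ℂ) x]
    simp only [quadForm, hBapp, inner_sub_left, inner_smul_left, Complex.conj_ofReal,
      Complex.sub_re, Complex.re_ofReal_mul]
    rfl
  have hBsym : (B : H →ₗ[ℂ] H).IsSymmetric := fun x y => by
    have := hT x y
    simp only [ContinuousLinearMap.coe_coe] at this ⊢
    rw [hBapp, hBapp, inner_sub_left, inner_sub_right, inner_smul_left, inner_smul_right,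
      Complex.conj_ofReal, this]
  have hBW : ∀ x ∈ Eᗮ, B x ∈ Eᗮ := fun x hx =>
    Submodule.sub_mem _ (Submodule.smul_mem _ _ hx) (hE' x hx)
  have hBpos : ∀ x ∈ Eᗮ, 0 ≤ quadForm B x := fun x hx => by
    rw [hBform]; linarith [hle x hx]
  let P : H →L[ℂ] H := F.starProjection
  have hd : 0 < M - c' := by linarith
  -- On Fᗮ the form of B = M - T is at least (M - c')‖u‖² with M - c' > 0, so B controls the
  -- component of w off F and P controls the rest.
  have hbound : ∀ w, ‖w‖ ≤ ((1 + ‖B‖) / (M - c') + 1) * (‖B w‖ + ‖P w‖) := fun w => by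
    set u := w - P w with hu
    have hum : u ∈ Fᗮ := Submodule.sub_starProjection_mem_orthogonal w
    have h1 : (M - c') * ‖u‖ ^ 2 ≤ (‖B w‖ + ‖B‖ * ‖P w‖) * ‖u‖ := by
      calc (M - c') * ‖u‖ ^ 2 ≤ quadForm B u := by
            rw [hBform]; linarith [hFc u hum]
        _ ≤ ‖inner ℂ (B u) u‖ := Complex.re_le_norm _
        _ ≤ ‖B u‖ * ‖u‖ := norm_inner_le_norm _ _
        _ ≤ _ := by
          gcongr
          rw [hu, map_sub]
          exact (norm_sub_le _ _).trans (by gcongr; exact B.le_opNorm _)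
    have h2 : ‖u‖ ≤ (1 + ‖B‖) / (M - c') * (‖B w‖ + ‖P w‖) := by
      rw [div_mul_eq_mul_div, le_div_iff₀ hd]
      rcases (norm_nonneg u).eq_or_lt with h0 | h0
      · rw [← h0]; simp; positivity
      · have : (M - c') * ‖u‖ ≤ ‖B w‖ + ‖B‖ * ‖P w‖ :=
          le_of_mul_le_mul_right (by nlinarith) h0
        nlinarith [norm_nonneg B, norm_nonneg (B w), norm_nonneg (P w),
          mul_nonneg (norm_nonneg B) (norm_nonneg (B w))]
    have h3 : ‖w‖ ≤ ‖u‖ + ‖P w‖ := by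
      simpa [hu] using norm_add_le u (P w)
    nlinarith [norm_nonneg (B w)]
  obtain ⟨s, -, hs, hsS⟩ := exists_seq_tendsto_sSup (S := S) ⟨_, hunit x₀ hx₀ hx₀0⟩ hSb
  choose x hx hxs using hsS
  -- Along a maximizing sequence the form of B tends to 0, and by `norm_sq_le_quadForm` so does B
  -- itself.
  have hBx : Tendsto (fun k => B (x k)) atTop (𝓝 0) := by
    have h1 : Tendsto (fun k => Real.sqrt ((‖B‖ + 1) * (M - s k))) atTop (𝓝 0) := by
      have : Tendsto (fun k => (‖B‖ + 1) * (M - s k)) atTop (𝓝 ((‖B‖ + 1) * (M - M))) :=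
        (tendsto_const_nhds.sub hs).const_mul _
      simpa using this.sqrt
    refine squeeze_zero_norm (fun k => ?_) h1
    refine Real.le_sqrt_of_sq_le ((norm_sq_le_quadForm hBsym hBW hBpos (hx k).1).trans (le_of_eq ?_))
    rw [hBform, hxs, (hx k).2]; ring
  have hPb : ∀ k, F.orthogonalProjectionOnto (x k) ∈ Metric.closedBall (0 : F) 1 := fun k => by
    rw [mem_closedBall_zero_iff, ← (hx k).2]
    exact F.norm_orthogonalProjectionOnto_apply_le (x k)
  obtain ⟨p, -, φ, hφ, hp⟩ := tendsto_subseq_of_bounded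
    (Metric.isBounded_closedBall (x := (0 : F)) (r := 1)) hPb
  -- The pair (B, P) is bounded below, and its values on the subsequence converge because P has
  -- finite-dimensional range. The maximizing subsequence is therefore Cauchy.
  let L : H →L[ℂ] H × H := B.prod P
  have hL : AntilipschitzWith (2 * ((1 + ‖B‖) / (M - c') + 1)).toNNReal L := by
    refine ContinuousLinearMap.antilipschitz_of_bound L fun w => (hbound w).trans ?_
    have h0 : 0 ≤ (1 + ‖B‖) / (M - c') + 1 := by positivity
    rw [Real.coe_toNNReal _ (by positivity), mul_comm (2 : ℝ), mul_assoc]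
    gcongr
    have h1 : ‖B w‖ ≤ ‖L w‖ := norm_fst_le (L w)
    have h2 : ‖P w‖ ≤ ‖L w‖ := norm_snd_le (L w)
    linarith
  have hLx : Tendsto (fun k => L (x (φ k))) atTop (𝓝 (0, (p : H))) :=
    (hBx.comp hφ.tendsto_atTop).prodMk_nhds ((continuous_subtype_val.tendsto p).comp hp)
  have hcau : CauchySeq (fun k => x (φ k)) :=
    (hL.isUniformInducing L.uniformContinuous).cauchy_map_iff.1 hLx.cauchySeq
  obtain ⟨v, hv⟩ := cauchySeq_tendsto_of_complete hcau
  have hv1 : ‖v‖ = 1 := tendsto_nhds_unique hv.norm (by simp [(hx _).2])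
  refine ⟨M, hMb, v, ?_, ?_, ?_⟩
  · exact (Submodule.isClosed_orthogonal E).mem_of_tendsto hv
      (Eventually.of_forall fun k => (hx _).1)
  · rintro rfl; simp at hv1
  · have h1 : Tendsto (fun k => B (x (φ k))) atTop (𝓝 (B v)) := (B.continuous.tendsto v).comp hv
    have h2 := tendsto_nhds_unique h1 (hBx.comp hφ.tendsto_atTop)
    rw [hBapp, sub_eq_zero] at h2
    exact h2.symm

end Variational

/-! ### Spans of eigenvectors and counting of eigenvalues -/

theorem exists_orthonormal_eigenvectors {T : EllTwo →L[ℂ] EllTwo}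
    (hT : (T : EllTwo →ₗ[ℂ] EllTwo).IsSymmetric) (S : Finset ℝ) (hS : ↑S ⊆ eigenvalueSet T) :
    ∃ e : S → EllTwo, Orthonormal ℂ e ∧ ∀ μ : S, T (e μ) = ((μ : ℝ) : ℂ) • e μ := by
  have h : ∀ μ : S, ∃ v : EllTwo, ‖v‖ = 1 ∧ T v = ((μ : ℝ) : ℂ) • v := fun μ => by
    obtain ⟨v, hv⟩ := Module.End.HasEigenvalue.exists_hasEigenvector (hS μ.2)
    have hn : 0 < ‖v‖ := norm_pos_iff.2 hv.2
    refine ⟨((‖v‖⁻¹ : ℝ) : ℂ) • v, ?_, ?_⟩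
    · rw [norm_smul, Complex.norm_real, norm_inv, norm_norm, inv_mul_cancel₀ hn.ne']
    · have := hv.apply_eq_smul
      simp only [ContinuousLinearMap.coe_coe] at this
      rw [map_smul, this, smul_comm]
  choose e he1 he2 using h
  refine ⟨e, ⟨he1, fun μ ν hμν => ?_⟩, he2⟩
  have hne : ((μ : ℝ) : ℂ) ≠ ((ν : ℝ) : ℂ) := fun h =>
    hμν (Subtype.ext (Complex.ofReal_injective h))
  have := hT (e μ) (e ν)
  simp only [ContinuousLinearMap.coe_coe] at this
  rw [he2, he2, inner_smul_left, inner_smul_right, Complex.conj_ofReal, ← sub_eq_zero,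
    ← sub_mul] at this
  exact (mul_eq_zero.1 this).resolve_left (sub_ne_zero.2 hne)

/-- Distinct eigenvalues `μ ∈ S` give a space of dimension `card S` on which `‖x‖²`, `⟨T x, x⟩`
and `‖T x‖²` are the moments of one nonnegative weight on `S`. -/
theorem exists_eigenspan {T : EllTwo →L[ℂ] EllTwo}
    (hT : (T : EllTwo →ₗ[ℂ] EllTwo).IsSymmetric) (S : Finset ℝ) (hS : ↑S ⊆ eigenvalueSet T) :
    ∃ V : Submodule ℂ EllTwo, FiniteDimensional ℂ V ∧ Module.finrank ℂ V = S.card ∧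
      ∀ x ∈ V, ∃ a : S → ℝ, (∀ μ, 0 ≤ a μ) ∧ ‖x‖ ^ 2 = ∑ μ : S, a μ ∧
        quadForm T x = ∑ μ : S, (μ : ℝ) * a μ ∧ ‖T x‖ ^ 2 = ∑ μ : S, (μ : ℝ) ^ 2 * a μ := by
  obtain ⟨e, he, heT⟩ := exists_orthonormal_eigenvectors hT S hS
  refine ⟨Submodule.span ℂ (Set.range e), FiniteDimensional.span_of_finite ℂ (Set.finite_range e),
    ?_, fun x hx => ?_⟩
  · rw [finrank_span_eq_card he.linearIndependent, Fintype.card_coe]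
  · obtain ⟨l, rfl⟩ := (Submodule.mem_span_range_iff_exists_fun ℂ).1 hx
    have hTx : T (∑ μ : S, l μ • e μ) = ∑ μ : S, (((μ : ℝ) : ℂ) * l μ) • e μ := by
      rw [map_sum]
      refine Finset.sum_congr rfl fun μ _ => ?_
      rw [map_smul, heT, smul_smul, mul_comm]
    have hsq : ∀ z : ℂ, ((starRingEnd ℂ) z * z).re = ‖z‖ ^ 2 := fun z => by
      rw [← Complex.normSq_eq_conj_mul_self, Complex.ofReal_re, Complex.normSq_eq_norm_sq]
    refine ⟨fun μ => ‖l μ‖ ^ 2, fun μ => by positivity, ?_, ?_, ?_⟩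
    · rw [← inner_self_eq_norm_sq (𝕜 := ℂ), he.inner_sum, map_sum]
      exact Finset.sum_congr rfl fun μ _ => hsq _
    · rw [quadForm, hTx, he.inner_sum, Complex.re_sum]
      refine Finset.sum_congr rfl fun μ _ => ?_
      rw [map_mul, Complex.conj_ofReal, mul_assoc, Complex.re_ofReal_mul, hsq]
    · rw [hTx, ← inner_self_eq_norm_sq (𝕜 := ℂ), he.inner_sum, map_sum]
      refine Finset.sum_congr rfl fun μ _ => ?_
      refine (hsq _).trans ?_
      rw [norm_mul, mul_pow, Complex.norm_real, Real.norm_eq_abs, sq_abs]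

theorem exists_eigenspan_quadForm_ge {T : EllTwo →L[ℂ] EllTwo}
    (hT : (T : EllTwo →ₗ[ℂ] EllTwo).IsSymmetric) (S : Finset ℝ) (hS : ↑S ⊆ eigenvalueSet T)
    {b : ℝ} (hb : ∀ μ ∈ S, b ≤ μ) :
    ∃ V : Submodule ℂ EllTwo, FiniteDimensional ℂ V ∧ Module.finrank ℂ V = S.card ∧
      ∀ x ∈ V, b * ‖x‖ ^ 2 ≤ quadForm T x := by
  obtain ⟨V, hV, hVc, h⟩ := exists_eigenspan hT S hS
  refine ⟨V, hV, hVc, fun x hx => ?_⟩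
  obtain ⟨a, ha, h1, h2, -⟩ := h x hx
  rw [h1, h2, Finset.mul_sum]
  exact Finset.sum_le_sum fun μ _ => mul_le_mul_of_nonneg_right (hb μ μ.2) (ha μ)

/-- If the form of `T` exceeds `b` on a space of dimension `j`, then `T` has at least `j`
eigenvalues above `b`. -/
theorem le_ncard_eigenvalues {T : EllTwo →L[ℂ] EllTwo}
    (hT : (T : EllTwo →ₗ[ℂ] EllTwo).IsSymmetric) {c : ℝ} (hess : EssentiallyBounded T c)
    (hfin : (eigenvalueSet T).Finite)
    (hsimple : ∀ μ ∈ eigenvalueSet T,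
      Module.finrank ℂ (Module.End.eigenspace (T : Module.End ℂ EllTwo) (μ : ℂ)) = 1)
    {b : ℝ} (hb : c ≤ b) (V : Submodule ℂ EllTwo) [FiniteDimensional ℂ V]
    (hV : ∀ x ∈ V, x ≠ 0 → b * ‖x‖ ^ 2 < quadForm T x) :
    Module.finrank ℂ V ≤ (eigenvalueSet T ∩ Ioi b).ncard := by
  by_contra! hlt
  have hSf : (eigenvalueSet T ∩ Ioi b).Finite := hfin.inter_of_left _
  set S := hSf.toFinset with hS
  rw [Set.ncard_eq_toFinset_card _ hSf] at hlt
  have hmem : ∀ μ, μ ∈ S ↔ μ ∈ eigenvalueSet T ∧ b < μ := fun μ => by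
    rw [hS, Set.Finite.mem_toFinset]; rfl
  obtain ⟨e, he, heT⟩ := exists_orthonormal_eigenvectors hT S fun μ hμ => ((hmem μ).1 hμ).1
  set E := Submodule.span ℂ (Set.range e) with hE
  have hEfd : FiniteDimensional ℂ E := FiniteDimensional.span_of_finite ℂ (Set.finite_range e)
  have hEc : Module.finrank ℂ E = S.card := by
    rw [hE, finrank_span_eq_card he.linearIndependent, Fintype.card_coe]
  have hEinv : ∀ x ∈ E, T x ∈ E := fun x hx => by
    obtain ⟨l, rfl⟩ := (Submodule.mem_span_range_iff_exists_fun ℂ).1 hx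
    rw [map_sum]
    refine Submodule.sum_mem _ fun μ _ => ?_
    rw [map_smul, heT]
    exact Submodule.smul_mem _ _ (Submodule.smul_mem _ _ (Submodule.subset_span ⟨μ, rfl⟩))
  -- If V were larger than the span E of the known eigenvectors above b, some nonzero x in V would
  -- be orthogonal to E, and the Rayleigh quotient of x would produce one more eigenvector above b,
  -- orthogonal to E.
  let f : V →ₗ[ℂ] E := (E.orthogonalProjectionOnto : EllTwo →ₗ[ℂ] E) ∘ₗ V.subtype
  have hker : f.ker ≠ ⊥ := LinearMap.ker_ne_bot_of_finrank_lt (by rw [hEc]; exact hlt)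
  obtain ⟨x, hx, hx0⟩ := (Submodule.ne_bot_iff _).1 hker
  have hxE : (x : EllTwo) ∈ Eᗮ :=
    Submodule.orthogonalProjectionOnto_eq_zero_iff.1 hx
  obtain ⟨M, hM, v, hvE, hv0, hv⟩ := exists_eigenvector_orthogonal hT hess hEinv hb hxE
    (hV x x.2 (by simpa using hx0))
  have hvec : Module.End.HasEigenvector (T : Module.End ℂ EllTwo) (M : ℂ) v :=
    ⟨Module.End.mem_eigenspace_iff.2 hv, hv0⟩
  -- The new eigenvalue M already belongs to S, so by simplicity v is a multiple of the chosen
  -- eigenvector for M. Then v lies in both E and Eᗮ, a contradiction.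
  have hMS : M ∈ S := (hmem M).2 ⟨Module.End.hasEigenvalue_of_hasEigenvector hvec, hM⟩
  have heM : e ⟨M, hMS⟩ ∈ Module.End.eigenspace (T : Module.End ℂ EllTwo) (M : ℂ) :=
    Module.End.mem_eigenspace_iff.2 (heT ⟨M, hMS⟩)
  obtain ⟨w, -, hw⟩ := finrank_eq_one_iff'.1 (hsimple M ((hmem M).1 hMS).1)
  have he0 : e ⟨M, hMS⟩ ≠ 0 := he.ne_zero _
  obtain ⟨c₁, hc₁⟩ := hw ⟨_, heM⟩
  obtain ⟨c₂, hc₂⟩ := hw ⟨_, hvec.1⟩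
  have h1 : c₁ • (w : EllTwo) = e ⟨M, hMS⟩ := congrArg Subtype.val hc₁
  have h2 : c₂ • (w : EllTwo) = v := congrArg Subtype.val hc₂
  have hc₁0 : c₁ ≠ 0 := by
    rintro rfl
    exact he0 (by rw [← h1, zero_smul])
  have hvE' : v ∈ E := by
    have : v = (c₂ * c₁⁻¹) • e ⟨M, hMS⟩ := by
      rw [← h1, smul_smul, mul_assoc, inv_mul_cancel₀ hc₁0, mul_one, h2]
    rw [this]
    exact Submodule.smul_mem _ _ (Submodule.subset_span ⟨_, rfl⟩)
  exact hv0 (by simpa using Submodule.inner_right_of_mem_orthogonal hvE' hvE)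

/-! ### Coordinates, truncation and symmetry -/

/-- The coordinate of `x ∈ ℓ²` at `n = i + 1`. -/
def coord (x : EllTwo) (i : ℕ) : ℂ := x i.succPNat

/-- The truncation of `x ∈ ℓ²` to the indices `n ≤ M`. -/
noncomputable def truncate (x : EllTwo) (M : ℕ) : EllTwo :=
  ∑ i ∈ Finset.range M, lp.single 2 i.succPNat (coord x i)

theorem tendsto_truncate (x : EllTwo) : Tendsto (truncate x) atTop (𝓝 x) := by
  have h := lp.hasSum_single (p := 2) (by norm_num) x
  rw [← Equiv.pnatEquivNat.symm.hasSum_iff] at h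
  exact h.tendsto_sum_nat

theorem cast_succPNat (i : ℕ) : (((i.succPNat : ℕ+) : ℕ) : ℝ) = i + 1 := by
  rw [Nat.succPNat_coe]; push_cast; ring

theorem coord_truncate (x : EllTwo) (M i : ℕ) :
    coord (truncate x M) i = if i < M then coord x i else 0 := by
  have h : coord (truncate x M) i =
      ∑ j ∈ Finset.range M, (lp.single 2 j.succPNat (coord x j) : EllTwo) i.succPNat := by
    rw [coord, truncate, lp.coeFn_sum, Finset.sum_apply]
  rw [h]
  have h2 : ∀ j, (lp.single 2 j.succPNat (coord x j) : EllTwo) i.succPNat =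
      if i = j then coord x j else 0 := fun j => by
    rw [lp.coeFn_single, Pi.single_apply]
    simp only [Nat.succPNat_injective.eq_iff]
  simp only [h2, Finset.sum_ite_eq, Finset.mem_range]

theorem hasSum_coord_inner (x y : EllTwo) :
    HasSum (fun i => inner ℂ (coord x i) (coord y i)) (inner ℂ x y) := by
  have h := lp.hasSum_inner (𝕜 := ℂ) x y
  rw [← Equiv.pnatEquivNat.symm.hasSum_iff] at h
  exact h

theorem hasSum_coord_sq (x : EllTwo) : HasSum (fun i => ‖coord x i‖ ^ 2) (‖x‖ ^ 2) := by
  have h := Complex.hasSum_re (hasSum_coord_inner x x)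
  convert h using 1
  · funext i; exact (inner_self_eq_norm_sq (𝕜 := ℂ) (coord x i)).symm
  · exact (inner_self_eq_norm_sq (𝕜 := ℂ) x).symm

theorem ext_coord {x y : EllTwo} (h : ∀ i, coord x i = coord y i) : x = y := by
  ext n
  have := h n.natPred
  rwa [coord, coord, PNat.succPNat_natPred] at this

/-- The entry of the matrix at the row `i + 1` and the column `j + 1`. -/
noncomputable def entry (α : ℝ) (i j : ℕ) : ℝ := hardyKernel α (i + 1) (j + 1)

theorem entry_comm (α : ℝ) (i j : ℕ) : entry α i j = entry α j i := kernel_comm _ _ _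

theorem summable_coord_hardyOp {α : ℝ} (hα : 0 < α) (x : EllTwo) (i : ℕ) :
    Summable fun j => ((entry α i j : ℝ) : ℂ) * coord x j := by
  have h := (summable_norm_entry hα x i.succPNat).of_norm
  rw [← Equiv.pnatEquivNat.symm.summable_iff] at h
  simpa [entry, coord, Function.comp_def, cast_succPNat, Equiv.pnatEquivNat] using h

theorem coord_hardyOp {α : ℝ} (hα : 0 < α) (x : EllTwo) (i : ℕ) :
    coord (hardyOp α x) i = ∑' j, ((entry α i j : ℝ) : ℂ) * coord x j := by
  rw [coord, hardyOp_apply hα, ← Equiv.pnatEquivNat.symm.tsum_eq]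
  simp [entry, coord, Equiv.pnatEquivNat]

theorem coord_hardyOp_truncate {α : ℝ} (hα : 0 < α) (x : EllTwo) (M i : ℕ) :
    coord (hardyOp α (truncate x M)) i =
      ∑ j ∈ Finset.range M, ((entry α i j : ℝ) : ℂ) * coord x j := by
  rw [coord_hardyOp hα, tsum_eq_sum (s := Finset.range M)]
  · refine Finset.sum_congr rfl fun j hj => ?_
    rw [coord_truncate, if_pos (Finset.mem_range.1 hj)]
  · intro j hj
    rw [coord_truncate, if_neg (by simpa using hj), mul_zero]

theorem inner_truncate_left (x y : EllTwo) (M : ℕ) :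
    inner ℂ (truncate x M) y = ∑ i ∈ Finset.range M, inner ℂ (coord x i) (coord y i) := by
  rw [truncate, sum_inner]
  exact Finset.sum_congr rfl fun i _ => lp.inner_single_left _ _ _

theorem inner_truncate_right (x y : EllTwo) (M : ℕ) :
    inner ℂ y (truncate x M) = ∑ i ∈ Finset.range M, inner ℂ (coord y i) (coord x i) := by
  rw [truncate, inner_sum]
  exact Finset.sum_congr rfl fun i _ => lp.inner_single_right _ _ _

/-- On truncated vectors both sides are finite double sums, so symmetry of the real entries suffices
and no infinite sums are interchanged; continuity does the rest. -/
theorem isSymmetric_hardyOp {α : ℝ} (hα : 0 < α) :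
    (hardyOp α : EllTwo →ₗ[ℂ] EllTwo).IsSymmetric := fun x y => by
  have h1 : Tendsto (fun M => inner ℂ (hardyOp α (truncate x M)) (truncate y M)) atTop
      (𝓝 (inner ℂ (hardyOp α x) y)) :=
    (((hardyOp α).continuous.tendsto x).comp (tendsto_truncate x)).inner (tendsto_truncate y)
  have h2 : Tendsto (fun M => inner ℂ (truncate x M) (hardyOp α (truncate y M))) atTop
      (𝓝 (inner ℂ x (hardyOp α y))) :=
    (tendsto_truncate x).inner (((hardyOp α).continuous.tendsto y).comp (tendsto_truncate y))
  refine tendsto_nhds_unique h1 (h2.congr fun M => ?_)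
  simp only [inner_truncate_left, inner_truncate_right, coord_hardyOp_truncate hα, inner_sum,
    sum_inner]
  rw [Finset.sum_comm]
  refine Finset.sum_congr rfl fun i _ => Finset.sum_congr rfl fun j _ => ?_
  rw [entry_comm α i j]
  simp only [RCLike.inner_apply, map_mul, Complex.conj_ofReal]
  ring

/-- The truncated real quadratic form `∑_{n, m ≤ M} k_α(n, m) u(n) u(m)`. -/
noncomputable def realForm (α : ℝ) (u : ℕ → ℝ) (M : ℕ) : ℝ :=
  ∑ i ∈ Finset.range M, ∑ j ∈ Finset.range M, entry α i j * (u i * u j)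

/-- The matrix is real, so the real part of the form contains no products of a real with an
imaginary part. Inequalities for the form thus reduce to real sequences. -/
theorem quadForm_truncate {α : ℝ} (hα : 0 < α) (x : EllTwo) (M : ℕ) :
    quadForm (hardyOp α) (truncate x M) =
      realForm α (fun i => (coord x i).re) M + realForm α (fun i => (coord x i).im) M := by
  simp only [quadForm, inner_truncate_right, coord_hardyOp_truncate hα, realForm, sum_inner,
    Complex.re_sum, ← Finset.sum_add_distrib]
  refine Finset.sum_congr rfl fun i _ => Finset.sum_congr rfl fun j _ => ?_
  simp [Complex.mul_re, Complex.mul_im]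
  ring

theorem tendsto_realForm {α : ℝ} (hα : 0 < α) (x : EllTwo) :
    Tendsto (fun M => realForm α (fun i => (coord x i).re) M +
      realForm α (fun i => (coord x i).im) M) atTop (𝓝 (quadForm (hardyOp α) x)) := by
  simp only [← quadForm_truncate hα]
  exact ((continuous_quadForm _).tendsto x).comp (tendsto_truncate x)

/-! ### The scale-invariant kernel and the distance to the diagonal matrix -/

/-- The ratio `((i + 1) / (i + 2))^α` of consecutive powers. -/
noncomputable def stepRatio (α : ℝ) (i : ℕ) : ℝ := (((i : ℝ) + 1) / (i + 2)) ^ α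

/-- The scale-invariant kernel `(min / max)^α` at `i + 1` and `j + 1`. -/
noncomputable def ratioKernel (α : ℝ) (i j : ℕ) : ℝ :=
  ((min (i : ℝ) j + 1) / (max (i : ℝ) j + 1)) ^ α

theorem stepRatio_pos (α : ℝ) (i : ℕ) : 0 < stepRatio α i :=
  Real.rpow_pos_of_pos (by positivity) _

theorem stepRatio_lt_one {α : ℝ} (hα : 0 < α) (i : ℕ) : stepRatio α i < 1 :=
  Real.rpow_lt_one (by positivity) (by rw [div_lt_one (by positivity)]; linarith) hα

theorem inv_stepRatio (α : ℝ) (i : ℕ) : (stepRatio α i)⁻¹ = (1 + 1 / ((i : ℝ) + 1)) ^ α := by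
  rw [stepRatio, ← Real.inv_rpow (by positivity)]
  congr 1
  field_simp
  ring

theorem stepRatio_eq (α : ℝ) (i : ℕ) : stepRatio α i = (1 + -(1 / ((i : ℝ) + 2))) ^ α := by
  rw [stepRatio]
  congr 1
  field_simp
  ring

theorem one_add_le_inv_stepRatio {α : ℝ} (hα : 0 < α) (i : ℕ) :
    1 + α / (i + 2) ≤ (stepRatio α i)⁻¹ := by
  have h0 : (0 : ℝ) < 1 + 1 / ((i : ℝ) + 1) := by positivity
  rw [inv_stepRatio, Real.rpow_def_of_pos h0]
  have h1 : 1 / ((i : ℝ) + 2) ≤ Real.log (1 + 1 / ((i : ℝ) + 1)) := by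
    refine le_trans (le_of_eq ?_) (Real.one_sub_inv_le_log_of_pos h0)
    field_simp
    ring
  have h2 := Real.add_one_le_exp (Real.log (1 + 1 / ((i : ℝ) + 1)) * α)
  have h3 : α / (i + 2) ≤ Real.log (1 + 1 / ((i : ℝ) + 1)) * α := by
    calc α / (i + 2) = 1 / ((i : ℝ) + 2) * α := by ring
      _ ≤ _ := by gcongr
  linarith

theorem one_add_le_inv_stepRatio_of_one_le {α : ℝ} (hα : 1 ≤ α) (i : ℕ) :
    1 + α / (i + 1) ≤ (stepRatio α i)⁻¹ := by
  rw [inv_stepRatio, div_eq_mul_one_div]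
  exact one_add_mul_self_le_rpow_one_add (by linarith [show (0 : ℝ) ≤ 1 / ((i : ℝ) + 1) by positivity]) hα

theorem stepRatio_le_of_le_one {α : ℝ} (hα : 0 < α) (hα1 : α ≤ 1) (i : ℕ) :
    stepRatio α i ≤ 1 - α / (i + 2) := by
  rw [stepRatio_eq]
  refine (rpow_one_add_le_one_add_mul_self ?_ hα.le hα1).trans (le_of_eq (by ring))
  have : 1 / ((i : ℝ) + 2) ≤ 1 := by
    rw [div_le_one (by positivity)]
    linarith [show (0 : ℝ) ≤ i by positivity]
  linarith

theorem ratioKernel_comm (α : ℝ) (i j : ℕ) : ratioKernel α i j = ratioKernel α j i := by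
  rw [ratioKernel, ratioKernel, min_comm, max_comm]

theorem ratioKernel_self (α : ℝ) (i : ℕ) : ratioKernel α i i = 1 := by
  rw [ratioKernel, min_self, max_self, div_self (by positivity), Real.one_rpow]

theorem ratioKernel_nonneg (α : ℝ) (i j : ℕ) : 0 ≤ ratioKernel α i j := by
  unfold ratioKernel; positivity

/-- Together with `ratioKernel_eq_mul_succ` this is the multiplicativity of the kernel along ordered
indices; every recursion below rests on it. -/
theorem ratioKernel_succ {i j : ℕ} (α : ℝ) (h : j ≤ i) :
    ratioKernel α (i + 1) j = stepRatio α i * ratioKernel α i j := by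
  have h1 : (j : ℝ) ≤ i := by exact_mod_cast h
  have h2 : (j : ℝ) ≤ i + 1 := by linarith
  rw [ratioKernel, ratioKernel, stepRatio]
  push_cast
  rw [min_eq_right h1, max_eq_left h1, min_eq_right h2, max_eq_left h2,
    ← Real.mul_rpow (by positivity) (by positivity)]
  congr 1
  field_simp
  ring

theorem ratioKernel_eq_mul_succ {i j : ℕ} (α : ℝ) (h : i < j) :
    ratioKernel α i j = stepRatio α i * ratioKernel α (i + 1) j := by
  have h2 : (i : ℝ) + 1 ≤ j := by exact_mod_cast h
  have h1 : (i : ℝ) ≤ j := by linarith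
  rw [ratioKernel, ratioKernel, stepRatio]
  push_cast
  rw [min_eq_left h1, max_eq_right h1, min_eq_left h2, max_eq_right h2,
    ← Real.mul_rpow (by positivity) (by positivity)]
  congr 1
  field_simp
  ring

theorem entry_eq (α : ℝ) (i j : ℕ) :
    entry α i j = ratioKernel α i j / (√((i : ℝ) + 1) * √((j : ℝ) + 1)) := by
  wlog h : j ≤ i generalizing i j
  · rw [entry_comm, this j i (by omega), ratioKernel_comm, mul_comm]
  have h1 : (j : ℝ) + 1 ≤ i + 1 := by exact_mod_cast Nat.succ_le_succ h
  have h1' : (j : ℝ) ≤ i := by linarith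
  have hx : (0 : ℝ) < (i : ℝ) + 1 := by positivity
  have hy : (0 : ℝ) < (j : ℝ) + 1 := by positivity
  rw [entry, hardyKernel, ratioKernel, max_eq_left h1, max_eq_left h1', min_eq_right h1',
    ← Real.sqrt_mul hx.le, Real.sqrt_eq_rpow, Real.rpow_add (by positivity),
    Real.div_rpow hy.le hx.le, Real.mul_rpow hx.le hy.le (z := α), two_mul α, Real.rpow_add hx,
    Real.rpow_neg (by positivity)]
  field_simp

/-- The sums S_i obey S_(i+1) = ρ_i (S_i + 1/(i+1)) with ρ_i the step ratio. When ρ_i ≤ (1 +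
α/(i+1))⁻¹, which is Bernoulli's inequality for α ≥ 1, the bound 1/α is preserved. -/
theorem sum_ratioKernel_lower_le {α : ℝ} (hα : 0 < α) (i : ℕ) :
    ∑ j ∈ Finset.range i, ratioKernel α i j / ((j : ℝ) + 1) ≤ 1 / α := by
  have hstep : ∀ i, ∑ j ∈ Finset.range (i + 1), ratioKernel α (i + 1) j / ((j : ℝ) + 1) =
      stepRatio α i * (∑ j ∈ Finset.range i, ratioKernel α i j / ((j : ℝ) + 1) + 1 / (i + 1)) := by
    intro i
    have hd : (1 : ℝ) / (i + 1) = ratioKernel α i i / ((i : ℝ) + 1) := by rw [ratioKernel_self]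
    rw [hd, ← Finset.sum_range_succ (fun j => ratioKernel α i j / ((j : ℝ) + 1)), Finset.mul_sum]
    refine Finset.sum_congr rfl fun j hj => ?_
    rw [ratioKernel_succ α (by simpa [Nat.lt_succ_iff] using hj)]
    ring
  rcases le_total 1 α with h | h
  · induction i with
    | zero => simp; positivity
    | succ i ih =>
      rw [hstep]
      have h1 := one_add_le_inv_stepRatio_of_one_le h i
      have h2 := stepRatio_pos α i
      rw [le_inv_comm₀ (by positivity) h2] at h1
      calc _ ≤ (1 + α / (i + 1))⁻¹ * (1 / α + 1 / (i + 1)) := by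
            gcongr
            exact add_nonneg (Finset.sum_nonneg fun j _ =>
              div_nonneg (ratioKernel_nonneg _ _ _) (by positivity)) (by positivity)
        _ = _ := by field_simp
  -- For α ≤ 1 Bernoulli's inequality reverses. The induction then runs on the sum including the
  -- diagonal term 1/(i+1), for which ρ_i ≤ 1 - α/(i+2) preserves 1/α exactly.
  · have key : ∀ i, ∑ j ∈ Finset.range i, ratioKernel α i j / ((j : ℝ) + 1) + 1 / ((i : ℝ) + 1) ≤
        1 / α := by
      intro i
      induction i with
      | zero => simp; exact (one_le_inv₀ hα).2 h
      | succ i ih =>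
        rw [hstep]
        have h1 := stepRatio_le_of_le_one hα h i
        have h2 := stepRatio_pos α i
        calc _ ≤ (1 - α / (i + 2)) * (1 / α) + 1 / (((i + 1 : ℕ) : ℝ) + 1) := by
              gcongr
              · exact add_nonneg (Finset.sum_nonneg fun j _ =>
                  div_nonneg (ratioKernel_nonneg _ _ _) (by positivity)) (by positivity)
              · exact h2.le.trans h1
          _ = _ := by push_cast; field_simp; ring
    have := key i
    have h0 : (0 : ℝ) ≤ 1 / ((i : ℝ) + 1) := by positivity
    linarith

/-- The recursion now runs downwards from M: U_i = ρ_i (1/(i+2) + U_(i+1)), and ρ_i ≤ (1 +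
α/(i+2))⁻¹ preserves 1/α for every α > 0. -/
theorem sum_ratioKernel_upper_le {α : ℝ} (hα : 0 < α) (M i : ℕ) :
    ∑ j ∈ Finset.Ico (i + 1) M, ratioKernel α i j / ((j : ℝ) + 1) ≤ 1 / α := by
  induction h : M - i generalizing i with
  | zero =>
    rw [Finset.Ico_eq_empty (by omega)]
    simp; positivity
  | succ d ih =>
    rcases Nat.lt_or_ge (i + 1) M with hM | hM
    · have hs : ∑ j ∈ Finset.Ico (i + 1) M, ratioKernel α i j / ((j : ℝ) + 1) =
          stepRatio α i * (1 / (i + 2) +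
            ∑ j ∈ Finset.Ico (i + 1 + 1) M, ratioKernel α (i + 1) j / ((j : ℝ) + 1)) := by
        have h2 : (1 : ℝ) / (i + 2) = ratioKernel α (i + 1) (i + 1) / (((i + 1 : ℕ) : ℝ) + 1) := by
          rw [ratioKernel_self]; push_cast; ring
        rw [h2, ← Finset.sum_eq_sum_Ico_succ_bot hM
          (fun j => ratioKernel α (i + 1) j / ((j : ℝ) + 1)), Finset.mul_sum]
        refine Finset.sum_congr rfl fun j hj => ?_
        rw [ratioKernel_eq_mul_succ α (Finset.mem_Ico.1 hj).1]
        ring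
      have h1 := one_add_le_inv_stepRatio hα i
      have h2 := stepRatio_pos α i
      rw [le_inv_comm₀ (by positivity) h2] at h1
      rw [hs]
      calc _ ≤ (1 + α / (i + 2))⁻¹ * (1 / (i + 2) + 1 / α) := by
            gcongr
            · exact add_nonneg (by positivity) (Finset.sum_nonneg fun j _ =>
                div_nonneg (ratioKernel_nonneg _ _ _) (by positivity))
            · exact ih (i + 1) (by omega)
        _ = _ := by field_simp; ring
    · rw [Finset.Ico_eq_empty (by omega)]
      simp; positivity

/-- The Schur test for the off-diagonal part of the matrix, with the weights `n^(-1/2)`. -/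
theorem abs_realForm_sub_diagonal_le {α : ℝ} (hα : 0 < α) (u : ℕ → ℝ) (M : ℕ) :
    |realForm α u M - ∑ i ∈ Finset.range M, u i ^ 2 / ((i : ℝ) + 1)| ≤
      2 / α * ∑ i ∈ Finset.range M, u i ^ 2 := by
  let w : ℕ → ℕ → ℝ := fun i j => if i = j then 0 else ratioKernel α i j
  have hw0 : ∀ i j, 0 ≤ w i j := fun i j => by
    simp only [w]; split_ifs; exacts [le_rfl, ratioKernel_nonneg _ _ _]
  have hwc : ∀ i j, w i j = w j i := fun i j => by
    simp only [w, eq_comm (a := i), ratioKernel_comm α i j]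
  have hrow : ∀ i ∈ Finset.range M, ∑ j ∈ Finset.range M, w i j / ((j : ℝ) + 1) ≤ 2 / α := by
    intro i hi
    have hi' := Finset.mem_range.1 hi
    rw [← Finset.sum_range_add_sum_Ico _ hi'.le, Finset.sum_eq_sum_Ico_succ_bot hi']
    have h1 : ∑ j ∈ Finset.range i, w i j / ((j : ℝ) + 1) =
        ∑ j ∈ Finset.range i, ratioKernel α i j / ((j : ℝ) + 1) :=
      Finset.sum_congr rfl fun j hj => by
        simp only [w, if_neg (show i ≠ j from (Finset.mem_range.1 hj).ne')]
    have h2 : ∑ j ∈ Finset.Ico (i + 1) M, w i j / ((j : ℝ) + 1) =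
        ∑ j ∈ Finset.Ico (i + 1) M, ratioKernel α i j / ((j : ℝ) + 1) :=
      Finset.sum_congr rfl fun j hj => by
        simp only [w, if_neg (show i ≠ j by have := (Finset.mem_Ico.1 hj).1; omega)]
    have h3 : w i i = 0 := by simp [w]
    rw [h1, h2, h3, zero_div, zero_add]
    have := sum_ratioKernel_lower_le hα i
    have := sum_ratioKernel_upper_le hα M i
    have h4 : 2 / α = 1 / α + 1 / α := by ring
    linarith
  let f : ℕ → ℝ := fun i => u i / √((i : ℝ) + 1)
  have hf : ∀ i, f i ^ 2 * ((i : ℝ) + 1) = u i ^ 2 := fun i => by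
    simp only [f]
    rw [div_pow, Real.sq_sqrt (by positivity)]
    field_simp
  have hdec : realForm α u M - ∑ i ∈ Finset.range M, u i ^ 2 / ((i : ℝ) + 1) =
      ∑ i ∈ Finset.range M, ∑ j ∈ Finset.range M, w i j * (f i * f j) := by
    rw [realForm, ← Finset.sum_sub_distrib]
    refine Finset.sum_congr rfl fun i hi => ?_
    have h1 : u i ^ 2 / ((i : ℝ) + 1) =
        ∑ j ∈ Finset.range M, if i = j then u i ^ 2 / ((i : ℝ) + 1) else 0 := by
      rw [Finset.sum_ite_eq, if_pos hi]
    rw [h1, ← Finset.sum_sub_distrib]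
    refine Finset.sum_congr rfl fun j _ => ?_
    simp only [w, f]
    rw [entry_eq]
    split_ifs with hij
    · subst hij
      rw [ratioKernel_self, Real.mul_self_sqrt (by positivity)]
      ring
    · field_simp
      simp
  rw [hdec]
  have hterm : ∀ i j, |w i j * (f i * f j)| ≤
      1 / 2 * (u i ^ 2 * (w i j / ((j : ℝ) + 1))) + 1 / 2 * (u j ^ 2 * (w j i / ((i : ℝ) + 1))) := by
    intro i j
    rw [abs_mul, abs_of_nonneg (hw0 i j), hwc j i, ← hf i, ← hf j]
    have hi : (0 : ℝ) < (i : ℝ) + 1 := by positivity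
    have hj : (0 : ℝ) < (j : ℝ) + 1 := by positivity
    -- The arithmetic-geometric mean inequality is weighted so that f_i²(i+1) = u_i² factors out and
    -- leaves the row sums of w_ij/(j+1).
    have h1 : |f i * f j| ≤ 1 / 2 * (f i ^ 2 * ((i + 1) / (j + 1))) +
        1 / 2 * (f j ^ 2 * ((j + 1) / (i + 1))) := by
      rw [abs_mul, ← sq_abs (f i), ← sq_abs (f j)]
      have : 0 ≤ (|f i| * ((i : ℝ) + 1) - |f j| * (j + 1)) ^ 2 / (2 * ((i + 1) * (j + 1))) := by
        positivity
      have e : 1 / 2 * (|f i| ^ 2 * (((i : ℝ) + 1) / (j + 1))) +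
        1 / 2 * (|f j| ^ 2 * (((j : ℝ) + 1) / (i + 1))) - |f i| * |f j| =
          (|f i| * ((i : ℝ) + 1) - |f j| * (j + 1)) ^ 2 / (2 * ((i + 1) * (j + 1))) := by
        field_simp
        ring
      linarith
    calc w i j * |f i * f j| ≤ w i j * _ := mul_le_mul_of_nonneg_left h1 (hw0 i j)
      _ = _ := by ring
  calc _ ≤ ∑ i ∈ Finset.range M, ∑ j ∈ Finset.range M, |w i j * (f i * f j)| :=
        (Finset.abs_sum_le_sum_abs _ _).trans
          (Finset.sum_le_sum fun i _ => Finset.abs_sum_le_sum_abs _ _)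
    _ ≤ ∑ i ∈ Finset.range M, ∑ j ∈ Finset.range M, (1 / 2 * (u i ^ 2 * (w i j / ((j : ℝ) + 1))) +
          1 / 2 * (u j ^ 2 * (w j i / ((i : ℝ) + 1)))) :=
        Finset.sum_le_sum fun i _ => Finset.sum_le_sum fun j _ => hterm i j
    _ = ∑ i ∈ Finset.range M, u i ^ 2 * ∑ j ∈ Finset.range M, w i j / ((j : ℝ) + 1) := by
        simp only [Finset.sum_add_distrib]
        rw [Finset.sum_comm (f := fun i j => 1 / 2 * (u j ^ 2 * (w j i / ((i : ℝ) + 1))))]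
        simp only [← Finset.mul_sum]
        ring
    _ ≤ ∑ i ∈ Finset.range M, u i ^ 2 * (2 / α) :=
        Finset.sum_le_sum fun i hi => mul_le_mul_of_nonneg_left (hrow i hi) (sq_nonneg _)
    _ = _ := by rw [← Finset.sum_mul, mul_comm]

theorem abs_quadForm_sub_diagonal_le {α : ℝ} (hα : 0 < α) (x : EllTwo) :
    |quadForm (hardyOp α) x - ∑' i, ‖coord x i‖ ^ 2 / ((i : ℝ) + 1)| ≤ 2 / α * ‖x‖ ^ 2 := by
  have hs : Summable fun i => ‖coord x i‖ ^ 2 / ((i : ℝ) + 1) := by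
    refine (hasSum_coord_sq x).summable.of_nonneg_of_le (fun i => by positivity) fun i => ?_
    exact div_le_self (by positivity) (by linarith [show (0 : ℝ) ≤ i by positivity])
  have hn : ∀ i, ‖coord x i‖ ^ 2 = (coord x i).re ^ 2 + (coord x i).im ^ 2 := fun i => by
    rw [← Complex.normSq_eq_norm_sq, Complex.normSq_apply]; ring
  refine le_of_tendsto_of_tendsto' (((tendsto_realForm hα x).sub hs.hasSum.tendsto_sum_nat).abs)
    ((hasSum_coord_sq x).tendsto_sum_nat.const_mul (2 / α)) fun M => ?_
  have h1 := abs_realForm_sub_diagonal_le hα (fun i => (coord x i).re) M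
  have h2 := abs_realForm_sub_diagonal_le hα (fun i => (coord x i).im) M
  simp only [hn, add_div, Finset.sum_add_distrib, mul_add]
  refine le_trans (le_of_eq ?_) ((abs_add_le _ _).trans (add_le_add h1 h2))
  congr 1
  ring

theorem quadForm_hardyOp_le {α : ℝ} (hα : 0 < α) {x : EllTwo} {N : ℕ}
    (hx : ∀ i < N, coord x i = 0) :
    quadForm (hardyOp α) x ≤ (1 / ((N : ℝ) + 1) + 2 / α) * ‖x‖ ^ 2 := by
  have h := (abs_le.1 (abs_quadForm_sub_diagonal_le hα x)).2
  have h2 : ∑' i, ‖coord x i‖ ^ 2 / ((i : ℝ) + 1) ≤ 1 / ((N : ℝ) + 1) * ‖x‖ ^ 2 := by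
    rw [← (hasSum_coord_sq x).tsum_eq, ← tsum_mul_left]
    have hle : ∀ i, ‖coord x i‖ ^ 2 / ((i : ℝ) + 1) ≤ 1 / ((N : ℝ) + 1) * ‖coord x i‖ ^ 2 := by
      intro i
      rcases Nat.lt_or_ge i N with hi | hi
      · simp [hx i hi]
      · have : (N : ℝ) ≤ i := by exact_mod_cast hi
        rw [div_eq_mul_one_div, mul_comm]
        gcongr
    have hs := (hasSum_coord_sq x).summable.mul_left (1 / ((N : ℝ) + 1))
    exact (hs.of_nonneg_of_le (fun i => by positivity) hle).tsum_le_tsum hle hs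
  linarith

theorem le_quadForm_hardyOp {α : ℝ} (hα : 0 < α) {x : EllTwo} {N : ℕ}
    (hx : ∀ i, N < i → coord x i = 0) :
    (1 / ((N : ℝ) + 1) - 2 / α) * ‖x‖ ^ 2 ≤ quadForm (hardyOp α) x := by
  have h := (abs_le.1 (abs_quadForm_sub_diagonal_le hα x)).1
  have h2 : 1 / ((N : ℝ) + 1) * ‖x‖ ^ 2 ≤ ∑' i, ‖coord x i‖ ^ 2 / ((i : ℝ) + 1) := by
    rw [← (hasSum_coord_sq x).tsum_eq, ← tsum_mul_left]
    have hle : ∀ i, 1 / ((N : ℝ) + 1) * ‖coord x i‖ ^ 2 ≤ ‖coord x i‖ ^ 2 / ((i : ℝ) + 1) := by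
      intro i
      rcases Nat.lt_or_ge N i with hi | hi
      · simp [hx i hi]
      · have : (i : ℝ) ≤ N := by exact_mod_cast hi
        rw [div_eq_mul_one_div (‖coord x i‖ ^ 2), mul_comm]
        gcongr
    have hs : Summable fun i => ‖coord x i‖ ^ 2 / ((i : ℝ) + 1) := by
      refine (hasSum_coord_sq x).summable.of_nonneg_of_le (fun i => by positivity) fun i => ?_
      exact div_le_self (by positivity) (by linarith [show (0 : ℝ) ≤ i by positivity])
    exact ((hasSum_coord_sq x).summable.mul_left _).tsum_le_tsum hle hs
  linarith

/-- On vectors vanishing in the first N coordinates the diagonal part contributes at most 1/(N+1),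
and the off-diagonal part at most 2/α. -/
theorem essentiallyBounded_hardyOp {α : ℝ} (hα : 0 < α) :
    EssentiallyBounded (hardyOp α) (2 / α) := fun M hM => by
  obtain ⟨N, hN⟩ := exists_nat_one_div_lt (sub_pos.2 hM)
  let e : Fin N → EllTwo := fun i => lp.single 2 (i : ℕ).succPNat (1 : ℂ)
  refine ⟨Submodule.span ℂ (Set.range e), FiniteDimensional.span_of_finite ℂ (Set.finite_range e),
    1 / ((N : ℝ) + 1) + 2 / α, by linarith, fun x hx => quadForm_hardyOp_le hα fun i hi => ?_⟩
  have h := Submodule.inner_right_of_mem_orthogonal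
    (Submodule.subset_span (s := Set.range e) ⟨⟨i, hi⟩, rfl⟩) hx
  have h2 : inner ℂ (e ⟨i, hi⟩) x = inner ℂ (1 : ℂ) (coord x i) := lp.inner_single_left _ _ _
  rw [h2] at h
  simpa using h

theorem quadForm_smul_operator {H : Type*} [NormedAddCommGroup H] [InnerProductSpace ℂ H]
    (s : ℝ) (T : H →L[ℂ] H) (x : H) : quadForm ((s : ℂ) • T) x = s * quadForm T x := by
  rw [quadForm, smul_apply, inner_smul_left, Complex.conj_ofReal,
    Complex.re_ofReal_mul]
  rfl

theorem EssentiallyBounded.smul {H : Type*} [NormedAddCommGroup H] [InnerProductSpace ℂ H]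
    {T : H →L[ℂ] H} {c : ℝ} (h : EssentiallyBounded T c) {s : ℝ} (hs : 0 < s) :
    EssentiallyBounded ((s : ℂ) • T) (s * c) := fun M hM => by
  obtain ⟨F, hF, c', hc', hFc⟩ := h (M / s) (by rwa [gt_iff_lt, lt_div_iff₀' hs])
  refine ⟨F, hF, s * c', by rwa [lt_div_iff₀' hs] at hc', fun x hx => ?_⟩
  rw [quadForm_smul_operator, mul_assoc]
  exact mul_le_mul_of_nonneg_left (hFc x hx) hs.le

/-! ### The form as a sum of squares, and its positivity -/

/-- The lower triangular sums `∑_{j ≤ i} (min / max)^α f(j)`, defined by their recursion. -/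
noncomputable def lowerSum (α : ℝ) (f : ℕ → ℝ) : ℕ → ℝ
  | 0 => f 0
  | i + 1 => stepRatio α i * lowerSum α f i + f (i + 1)

theorem lowerSum_eq (α : ℝ) (f : ℕ → ℝ) (i : ℕ) :
    lowerSum α f i = ∑ j ∈ Finset.range (i + 1), ratioKernel α i j * f j := by
  induction i with
  | zero => simp [lowerSum, ratioKernel_self]
  | succ i ih =>
    rw [lowerSum, ih, Finset.sum_range_succ _ (i + 1), ratioKernel_self, one_mul, Finset.mul_sum]
    congr 1
    refine Finset.sum_congr rfl fun j hj => ?_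
    rw [ratioKernel_succ α (by simpa [Nat.lt_succ_iff] using hj), mul_assoc]

theorem lowerSum_eq_self {f : ℕ → ℝ} (α : ℝ) {k : ℕ} (h : ∀ i < k, f i = 0) :
    lowerSum α f k = f k := by
  rw [lowerSum_eq, Finset.sum_range_succ, ratioKernel_self, one_mul, Finset.sum_eq_zero, zero_add]
  intro j hj
  rw [h j (Finset.mem_range.1 hj), mul_zero]

/-- The weighted coordinates `u(n) / √n`. -/
noncomputable def scaled (u : ℕ → ℝ) (i : ℕ) : ℝ := u i / √((i : ℝ) + 1)

theorem realForm_eq (α : ℝ) (u : ℕ → ℝ) (M : ℕ) :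
    realForm α u M =
      ∑ i ∈ Finset.range M, ∑ j ∈ Finset.range M, ratioKernel α i j * (scaled u i * scaled u j) := by
  refine Finset.sum_congr rfl fun i _ => Finset.sum_congr rfl fun j _ => ?_
  rw [entry_eq, scaled, scaled]
  field_simp

/-- The new row and column contribute 2fρP + f² with f the new scaled coordinate, which is the
completed square (ρP + f)² - (ρP)². -/
theorem realForm_succ (α : ℝ) (u : ℕ → ℝ) (M : ℕ) :
    realForm α u (M + 2) = realForm α u (M + 1) +
      (lowerSum α (scaled u) (M + 1) ^ 2 - (stepRatio α M * lowerSum α (scaled u) M) ^ 2) := by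
  have h1 : lowerSum α (scaled u) (M + 1) =
      stepRatio α M * lowerSum α (scaled u) M + scaled u (M + 1) := rfl
  have h2 : ∑ j ∈ Finset.range (M + 1), ratioKernel α (M + 1) j * (scaled u (M + 1) * scaled u j) =
      scaled u (M + 1) * (stepRatio α M * lowerSum α (scaled u) M) := by
    rw [lowerSum_eq, Finset.mul_sum, Finset.mul_sum]
    refine Finset.sum_congr rfl fun j hj => ?_
    rw [ratioKernel_succ α (by simpa [Nat.lt_succ_iff] using hj)]
    ring
  have h3 : ∑ i ∈ Finset.range (M + 1), ratioKernel α i (M + 1) * (scaled u i * scaled u (M + 1)) =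
      scaled u (M + 1) * (stepRatio α M * lowerSum α (scaled u) M) := by
    rw [← h2]
    refine Finset.sum_congr rfl fun j _ => ?_
    rw [ratioKernel_comm, mul_comm (scaled u j)]
  rw [realForm_eq, realForm_eq, Finset.sum_range_succ _ (M + 1)]
  simp only [Finset.sum_range_succ _ (M + 1), Finset.sum_add_distrib]
  rw [h2, h3, h1, ratioKernel_self]
  ring

theorem realForm_one (α : ℝ) (u : ℕ → ℝ) :
    realForm α u 1 = lowerSum α (scaled u) 0 ^ 2 := by
  simp [realForm_eq, lowerSum, ratioKernel_self, sq]

/-- Summation by parts in `realForm_succ`: each square P_k² enters with coefficient 1 and leaves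
with coefficient ρ_k². -/
theorem realForm_eq_sum_sq (α : ℝ) (u : ℕ → ℝ) (M : ℕ) :
    realForm α u (M + 1) = lowerSum α (scaled u) M ^ 2 +
      ∑ k ∈ Finset.range M, (1 - stepRatio α k ^ 2) * lowerSum α (scaled u) k ^ 2 := by
  induction M with
  | zero => simp [realForm_one]
  | succ M ih => rw [realForm_succ, ih, Finset.sum_range_succ]; ring

theorem sum_le_realForm {α : ℝ} (u : ℕ → ℝ) {M : ℕ} :
    ∑ k ∈ Finset.range M, (1 - stepRatio α k ^ 2) * lowerSum α (scaled u) k ^ 2 ≤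
      realForm α u (M + 1) := by
  rw [realForm_eq_sum_sq]
  nlinarith [sq_nonneg (lowerSum α (scaled u) M)]

theorem one_sub_stepRatio_sq_pos {α : ℝ} (hα : 0 < α) (i : ℕ) : 0 < 1 - stepRatio α i ^ 2 := by
  have h1 := stepRatio_pos α i
  have h2 := stepRatio_lt_one hα i
  nlinarith

theorem exists_first_coord {x : EllTwo} (hx : x ≠ 0) :
    ∃ k, coord x k ≠ 0 ∧ ∀ i < k, coord x i = 0 := by
  classical
  have h : ∃ k, coord x k ≠ 0 := by
    by_contra! h
    exact hx (ext_coord fun i => by rw [h i]; rfl)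
  exact ⟨Nat.find h, Nat.find_spec h, fun i hi => not_not.1 (Nat.find_min h hi)⟩

/-- A lower bound for the truncated forms that only depends on the first nonzero coordinate
yields positivity of the limit form. -/
theorem pos_of_first_coord {x : EllTwo} (hx : x ≠ 0) {Q : (ℕ → ℝ) → ℕ → ℝ} {q : ℝ}
    (hlim : Tendsto (fun M => Q (fun i => (coord x i).re) M + Q (fun i => (coord x i).im) M)
      atTop (𝓝 q)) {δ : ℕ → ℝ → ℝ} (hδ0 : ∀ k, δ k 0 = 0) (hδ : ∀ k, ∀ t ≠ 0, 0 < δ k t)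
    (hQ : ∀ (u : ℕ → ℝ) (k : ℕ), (∀ i < k, u i = 0) → ∀ M, δ k (u k) ≤ Q u (k + M + 2)) :
    0 < q := by
  obtain ⟨k, hk, hk0⟩ := exists_first_coord hx
  have h0 : ∀ t, 0 ≤ δ k t := fun t => by
    rcases eq_or_ne t 0 with rfl | ht
    · exact (hδ0 k).ge
    · exact (hδ k t ht).le
  -- Strict inequalities between truncations could be lost in the limit; this lower bound does not
  -- depend on the truncation and survives.
  have h1 : δ k (coord x k).re + δ k (coord x k).im ≤ q := by
    refine ge_of_tendsto hlim ((eventually_ge_atTop (k + 2)).mono fun M hM => ?_)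
    obtain ⟨m, rfl⟩ := Nat.exists_eq_add_of_le hM
    have e : k + 2 + m = k + m + 2 := by ring
    rw [e]
    exact add_le_add (hQ (fun i => (coord x i).re) k (fun i hi => by simp [hk0 i hi]) m)
      (hQ (fun i => (coord x i).im) k (fun i hi => by simp [hk0 i hi]) m)
  refine lt_of_lt_of_le ?_ h1
  by_cases hre : (coord x k).re = 0
  · have him : (coord x k).im ≠ 0 := fun him => hk (Complex.ext hre him)
    linarith [hδ k _ him, h0 (coord x k).re]
  · linarith [hδ k _ hre, h0 (coord x k).im]

/-- Of the sum of squares only the term at the first nonzero coordinate is kept, where the lower sum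
reduces to that single coordinate. -/
theorem quadForm_hardyOp_pos {α : ℝ} (hα : 0 < α) {x : EllTwo} (hx : x ≠ 0) :
    0 < quadForm (hardyOp α) x := by
  refine pos_of_first_coord hx (tendsto_realForm hα x)
    (δ := fun k t => (1 - stepRatio α k ^ 2) * (t / √((k : ℝ) + 1)) ^ 2) (fun k => by simp)
    (fun k t ht => mul_pos (one_sub_stepRatio_sq_pos hα k) (by positivity)) fun u k hu M => ?_
  refine le_trans ?_ (sum_le_realForm u)
  have h1 : lowerSum α (scaled u) k = u k / √((k : ℝ) + 1) :=
    lowerSum_eq_self α fun i hi => by rw [scaled, hu i hi, zero_div]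
  rw [← h1]
  exact Finset.single_le_sum
    (f := fun k => (1 - stepRatio α k ^ 2) * lowerSum α (scaled u) k ^ 2)
    (fun i _ => mul_nonneg (one_sub_stepRatio_sq_pos hα i).le (sq_nonneg _))
    (Finset.mem_range.2 (by omega))

/-! ### Monotonicity of `α K_α` -/

/-- The storage function of the comparison between `β K_β` and `α K_α`. -/
noncomputable def storage (α β a b : ℝ) : ℝ :=
  ((α + β) * (β * b ^ 2 + α * a ^ 2) - 4 * α * β * (a * b)) / (β - α)

theorem storage_nonneg {α β : ℝ} (hα : 0 < α) (hβ : α < β) (a b : ℝ) : 0 ≤ storage α β a b := by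
  refine div_nonneg ?_ (by linarith)
  have h1 : 0 ≤ α * (β - α) * a ^ 2 :=
    mul_nonneg (mul_nonneg hα.le (by linarith)) (sq_nonneg a)
  have h2 : 0 ≤ β * (β - α) * b ^ 2 :=
    mul_nonneg (mul_nonneg (by linarith) (by linarith)) (sq_nonneg b)
  have h3 : 0 ≤ 2 * α * β * (a - b) ^ 2 := by
    have : 0 < β := by linarith
    positivity
  nlinarith [mul_nonneg hα.le (sq_nonneg a), sq_nonneg (α * a - β * b)]

theorem stepRatio_eq_exp (α : ℝ) (i : ℕ) :
    stepRatio α i = Real.exp (-(α * Real.log (((i : ℝ) + 2) / (i + 1)))) := by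
  rw [stepRatio, Real.rpow_def_of_pos (by positivity), ← inv_div, Real.log_inv]
  congr 1
  ring

/-- Along the flow a' = -αa, b' = -βb the storage decreases at a rate that is a perfect square, a
positive multiple of (βb - αa)² when 0 < α < β. One index step is this flow for the time T =
log((i+2)/(i+1)). -/
theorem storage_sub_eq_integral {α β : ℝ} (hβ : α < β) (a b T : ℝ) :
    storage α β a b - storage α β (Real.exp (-(α * T)) * a) (Real.exp (-(β * T)) * b) =
      ∫ τ in (0 : ℝ)..T, 2 * (α + β) / (β - α) *
        (β * (Real.exp (-(β * τ)) * b) - α * (Real.exp (-(α * τ)) * a)) ^ 2 := by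
  have hd : ∀ τ : ℝ, HasDerivAt
      (fun τ => -storage α β (Real.exp (-(α * τ)) * a) (Real.exp (-(β * τ)) * b))
      (2 * (α + β) / (β - α) *
        (β * (Real.exp (-(β * τ)) * b) - α * (Real.exp (-(α * τ)) * a)) ^ 2) τ := fun τ => by
    have he : ∀ γ c : ℝ, HasDerivAt (fun τ => Real.exp (-(γ * τ)) * c)
        (-γ * (Real.exp (-(γ * τ)) * c)) τ := fun γ c => by
      have := ((((hasDerivAt_id τ).const_mul γ).neg).exp).mul_const c
      refine this.congr_deriv ?_
      simp only [Pi.neg_apply, id]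
      ring
    have ha := he α a
    have hb := he β b
    unfold storage
    refine ((((((hb.pow 2).const_mul β).add ((ha.pow 2).const_mul α)).const_mul (α + β)).sub
      ((ha.mul hb).const_mul (4 * α * β))).div_const (β - α)).neg.congr_deriv ?_
    have : β - α ≠ 0 := by linarith
    field_simp
    push_cast
    ring
  rw [intervalIntegral.integral_eq_sub_of_hasDerivAt (fun τ _ => hd τ)
    (Continuous.intervalIntegrable (by fun_prop) _ _)]
  simp
  ring

theorem storage_stepRatio_le {α β : ℝ} (hα : 0 < α) (hβ : α < β) (a b : ℝ) (i : ℕ) :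
    storage α β (stepRatio α i * a) (stepRatio β i * b) ≤ storage α β a b := by
  rw [← sub_nonneg, stepRatio_eq_exp, stepRatio_eq_exp, storage_sub_eq_integral hβ]
  refine intervalIntegral.integral_nonneg (Real.log_nonneg ?_) fun τ _ => ?_
  · rw [le_div_iff₀ (by positivity)]; linarith
  · exact mul_nonneg (div_nonneg (by linarith) (by linarith)) (sq_nonneg _)

theorem storage_stepRatio_lt {α β : ℝ} (hα : 0 < α) (hβ : α < β) {a b : ℝ} (h : α * a ≠ β * b)
    (i : ℕ) : storage α β (stepRatio α i * a) (stepRatio β i * b) < storage α β a b := by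
  have hT : 0 < Real.log (((i : ℝ) + 2) / (i + 1)) :=
    Real.log_pos (by rw [lt_div_iff₀ (by positivity)]; linarith)
  have hC : 0 < 2 * (α + β) / (β - α) := div_pos (by linarith) (by linarith)
  rw [← sub_pos, stepRatio_eq_exp, stepRatio_eq_exp, storage_sub_eq_integral hβ]
  refine intervalIntegral.integral_pos hT (by fun_prop)
    (fun τ _ => mul_nonneg hC.le (sq_nonneg _)) ⟨0, ⟨le_rfl, hT.le⟩, ?_⟩
  simp only [mul_zero, neg_zero, Real.exp_zero, one_mul]
  exact mul_pos hC (pow_pos (abs_pos.2 (sub_ne_zero.2 h.symm)) 2 |>.trans_eq (sq_abs _))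

/-- The storage is chosen so that adding the same f to both lower sums raises it by exactly the
increment of β·form_β - α·form_α. What remains is the storage lost in the decay between consecutive
indices. -/
theorem realForm_sub_eq {α β : ℝ} (hβ : α < β) (u : ℕ → ℝ) (M : ℕ) :
    β * realForm β u (M + 1) - α * realForm α u (M + 1) =
      storage α β (lowerSum α (scaled u) M) (lowerSum β (scaled u) M) +
      ∑ k ∈ Finset.range M, (storage α β (lowerSum α (scaled u) k) (lowerSum β (scaled u) k) -
        storage α β (stepRatio α k * lowerSum α (scaled u) k)
          (stepRatio β k * lowerSum β (scaled u) k)) := by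
  have hd : β - α ≠ 0 := by linarith
  induction M with
  | zero =>
    simp only [zero_add, realForm_one, Finset.range_zero, Finset.sum_empty, add_zero, lowerSum,
      storage]
    field_simp
    ring
  | succ M ih =>
    rw [realForm_succ, realForm_succ, Finset.sum_range_succ]
    have e : ∀ A B f : ℝ, storage α β (A + f) (B + f) - storage α β A B =
        β * ((B + f) ^ 2 - B ^ 2) - α * ((A + f) ^ 2 - A ^ 2) := fun A B f => by
      unfold storage
      field_simp
      ring
    have := e (stepRatio α M * lowerSum α (scaled u) M) (stepRatio β M * lowerSum β (scaled u) M)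
      (scaled u (M + 1))
    simp only [lowerSum]
    linarith

theorem quadForm_hardyOp_strictMono {α β : ℝ} (hα : 0 < α) (hβ : α < β) {x : EllTwo}
    (hx : x ≠ 0) :
    quadForm ((α : ℂ) • hardyOp α) x < quadForm ((β : ℂ) • hardyOp β) x := by
  rw [quadForm_smul_operator, quadForm_smul_operator, ← sub_pos]
  have hlim : Tendsto (fun M =>
      (β * realForm β (fun i => (coord x i).re) M - α * realForm α (fun i => (coord x i).re) M) +
      (β * realForm β (fun i => (coord x i).im) M - α * realForm α (fun i => (coord x i).im) M))
      atTop (𝓝 (β * quadForm (hardyOp β) x - α * quadForm (hardyOp α) x)) := by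
    refine (((tendsto_realForm (hα.trans hβ) x).const_mul β).sub
      ((tendsto_realForm hα x).const_mul α)).congr fun M => ?_
    ring
  refine pos_of_first_coord hx (Q := fun u M => β * realForm β u M - α * realForm α u M) hlim
    (δ := fun k t => storage α β (t / √((k : ℝ) + 1)) (t / √((k : ℝ) + 1)) -
      storage α β (stepRatio α k * (t / √((k : ℝ) + 1))) (stepRatio β k * (t / √((k : ℝ) + 1))))
    (fun k => by simp [storage]) (fun k t ht => ?_) fun u k hu M => ?_
  -- At the first nonzero coordinate the two lower sums coincide and are nonzero, so αa ≠ βb and the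
  -- dissipation there is strictly positive.
  · refine sub_pos.2 (storage_stepRatio_lt hα hβ (fun h => ?_) k)
    have h2 : t / √((k : ℝ) + 1) ≠ 0 := div_ne_zero ht (Real.sqrt_ne_zero'.2 (by positivity))
    exact hβ.ne (mul_right_cancel₀ h2 h)
  · have h1 : ∀ γ, lowerSum γ (scaled u) k = u k / √((k : ℝ) + 1) := fun γ =>
      lowerSum_eq_self γ fun i hi => by rw [scaled, hu i hi, zero_div]
    change _ ≤ β * realForm β u (k + M + 1 + 1) - α * realForm α u (k + M + 1 + 1)
    rw [realForm_sub_eq hβ]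
    refine le_add_of_nonneg_of_le (storage_nonneg hα hβ _ _) ?_
    have h2 := Finset.single_le_sum
      (f := fun k => storage α β (lowerSum α (scaled u) k) (lowerSum β (scaled u) k) -
        storage α β (stepRatio α k * lowerSum α (scaled u) k)
          (stepRatio β k * lowerSum β (scaled u) k))
      (fun i _ => sub_nonneg.2 (storage_stepRatio_le hα hβ _ _ i))
      (Finset.mem_range.2 (show k < k + M + 1 by omega))
    simpa only [h1] using h2

/-! ### Asymptotics of the ratios -/

/-- The error constant in the first order expansion of `((i + 1) / (i + 2))^(±α)`. -/
noncomputable def expansionConst (α : ℝ) : ℝ := α ^ 2 + α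

theorem expansionConst_pos {α : ℝ} (hα : 0 < α) : 0 < expansionConst α := by
  unfold expansionConst; positivity

theorem log_step_bounds (i : ℕ) :
    1 / ((i : ℝ) + 1) - (1 / ((i : ℝ) + 1)) ^ 2 ≤ Real.log (((i : ℝ) + 2) / (i + 1)) ∧
      Real.log (((i : ℝ) + 2) / (i + 1)) ≤ 1 / ((i : ℝ) + 1) := by
  have h0 : (0 : ℝ) < ((i : ℝ) + 2) / (i + 1) := by positivity
  constructor
  · refine le_trans ?_ (Real.one_sub_inv_le_log_of_pos h0)
    rw [← sub_nonneg]
    have : 1 - (((i : ℝ) + 2) / (i + 1))⁻¹ - (1 / ((i : ℝ) + 1) - (1 / ((i : ℝ) + 1)) ^ 2) =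
        1 / (((i : ℝ) + 1) ^ 2 * (i + 2)) := by
      field_simp
      ring
    rw [this]
    positivity
  · refine (Real.log_le_sub_one_of_pos h0).trans (le_of_eq ?_)
    field_simp
    ring

/-- In the constant α² + α, the α² is the second-order remainder of the exponential, available
because α log((i+2)/(i+1)) ≤ 1, and the α comes from replacing the logarithm by 1/(i+1). -/
theorem abs_stepRatio_sub_le {α : ℝ} (hα : 0 < α) {i : ℕ} (hi : α ≤ i + 1) :
    |stepRatio α i - 1 + α * (1 / ((i : ℝ) + 1))| ≤
        expansionConst α * (1 / ((i : ℝ) + 1)) ^ 2 ∧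
      |(stepRatio α i)⁻¹ - 1 - α * (1 / ((i : ℝ) + 1))| ≤
        expansionConst α * (1 / ((i : ℝ) + 1)) ^ 2 := by
  obtain ⟨hl, hu⟩ := log_step_bounds i
  have hT0 : 0 ≤ Real.log (((i : ℝ) + 2) / (i + 1)) :=
    Real.log_nonneg (by rw [le_div_iff₀ (by positivity)]; linarith)
  rw [stepRatio_eq_exp, ← Real.exp_neg, neg_neg]
  set T := Real.log (((i : ℝ) + 2) / (i + 1))
  set h := 1 / ((i : ℝ) + 1) with hh
  have hh0 : 0 < h := by positivity
  have hαh : α * h ≤ 1 := by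
    rw [hh, mul_one_div, div_le_one (by positivity)]; exact hi
  have ht0 : 0 ≤ α * T := by positivity
  have ht1 : α * T ≤ α * h := by gcongr
  have hsq : (α * T) ^ 2 ≤ α ^ 2 * h ^ 2 := by rw [← mul_pow]; gcongr
  have hd : α * h - α * T ≤ α * h ^ 2 := by nlinarith
  have h1 := abs_le.1 (Real.abs_exp_sub_one_sub_id_le (x := -(α * T))
    (by rw [abs_neg, abs_of_nonneg ht0]; linarith))
  have h2 := abs_le.1 (Real.abs_exp_sub_one_sub_id_le (x := α * T)
    (by rw [abs_of_nonneg ht0]; linarith))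
  rw [neg_sq] at h1
  unfold expansionConst
  constructor <;> rw [abs_le] <;> constructor <;> nlinarith

theorem one_sub_stepRatio_le {α : ℝ} (hα : 0 < α) (i : ℕ) :
    1 - stepRatio α i ≤ α * (1 / ((i : ℝ) + 1)) := by
  have h1 := (log_step_bounds i).2
  rw [stepRatio_eq_exp]
  have h2 := Real.add_one_le_exp (-(α * Real.log (((i : ℝ) + 2) / (i + 1))))
  have h3 := mul_le_mul_of_nonneg_left h1 hα.le
  linarith

/-! ### Sequences with small increments -/

/-- Otherwise comparison with ε/(i+1) contradicts the divergence of the harmonic series. Here it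
takes the place of convergence to zero. -/
theorem exists_lt_of_summable {g : ℕ → ℝ} (hs : Summable fun i : ℕ => 1 / ((i : ℝ) + 1) * g i)
    {ε : ℝ} (hε : 0 < ε) (n : ℕ) : ∃ k ≥ n, g k < ε := by
  by_contra! h
  have h1 : Summable fun i : ℕ => ε * (1 / (((i + n : ℕ) : ℝ) + 1)) := by
    refine ((summable_nat_add_iff n).2 hs).of_nonneg_of_le (fun i => by positivity) fun i => ?_
    rw [mul_comm]
    gcongr
    exact h _ (by omega)
  rw [summable_mul_left_iff hε.ne'] at h1
  have h2 := (summable_nat_add_iff (f := fun i : ℕ => 1 / ((i : ℝ) + 1)) n).1 h1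
  have h3 := (summable_nat_add_iff (f := fun i : ℕ => 1 / (i : ℝ)) 1).1 (by simpa using h2)
  exact Real.not_summable_one_div_natCast h3

/-- `(i + 1)^(-1/2)`. -/
noncomputable def rootWeight (i : ℕ) : ℝ := 1 / √((i : ℝ) + 1)

theorem rootWeight_pos (i : ℕ) : 0 < rootWeight i := by unfold rootWeight; positivity

theorem rootWeight_sq (i : ℕ) : rootWeight i ^ 2 = 1 / ((i : ℝ) + 1) := by
  rw [rootWeight, div_pow, Real.sq_sqrt (by positivity), one_pow]

theorem rootWeight_succ_le (i : ℕ) : rootWeight (i + 1) ≤ rootWeight i := by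
  unfold rootWeight
  gcongr
  linarith

theorem tendsto_rootWeight : Tendsto rootWeight atTop (𝓝 0) := by
  have h := tendsto_one_div_add_atTop_nhds_zero_nat (𝕜 := ℝ)
  refine (by simpa using h.sqrt : Tendsto (fun n : ℕ => √(((n : ℝ) + 1)⁻¹)) atTop (𝓝 0)).congr ?_
  intro i
  rw [rootWeight, Real.sqrt_inv, one_div]

/-- A telescoping bound for n^(-3/2): increments of this size sum to a tail of size n^(-1/2). -/
theorem rootWeight_cube_le (i : ℕ) :
    rootWeight i ^ 3 ≤ 4 * (rootWeight i - rootWeight (i + 1)) := by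
  have hx : (0 : ℝ) < √((i : ℝ) + 1) := by positivity
  have hy : (0 : ℝ) < √((i : ℝ) + 1 + 1) := by positivity
  have hx2 : √((i : ℝ) + 1) ^ 2 = (i : ℝ) + 1 := Real.sq_sqrt (by positivity)
  have hy2 : √((i : ℝ) + 1 + 1) ^ 2 = (i : ℝ) + 1 + 1 := Real.sq_sqrt (by positivity)
  unfold rootWeight
  push_cast
  set x := √((i : ℝ) + 1)
  set y := √((i : ℝ) + 1 + 1)
  have hi : (0 : ℝ) ≤ i := by positivity
  have hyx : 2 * y ≤ 3 * x := by nlinarith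
  have hdiff : (y - x) * (y + x) = 1 := by nlinarith
  have hyx' : y * (x + y) ≤ 4 * x ^ 2 := by nlinarith
  have e : 1 / x - 1 / y = 1 / (x * y * (y + x)) := by
    rw [eq_div_iff (by positivity)]
    field_simp
    linarith
  rw [e, div_pow, one_pow, mul_one_div, div_le_div_iff₀ (by positivity) (by positivity)]
  nlinarith

/-- The increments telescope from m to a later index at which y is arbitrarily small. -/
theorem abs_le_of_increments {y : ℕ → ℝ} {K : ℝ} {n₀ : ℕ}
    (hy : ∀ i ≥ n₀, |y (i + 1) - y i| ≤ K * (rootWeight i - rootWeight (i + 1)))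
    (hK : 0 ≤ K) (hsmall : ∀ ε > 0, ∀ n, ∃ k ≥ n, |y k| < ε) {m : ℕ} (hm : n₀ ≤ m) :
    |y m| ≤ K * rootWeight m := by
  have h1 : ∀ d, |y (m + d) - y m| ≤ K * (rootWeight m - rootWeight (m + d)) := fun d => by
    induction d with
    | zero => simp
    | succ d ih =>
      have h2 := hy (m + d) (by omega)
      have h3 := abs_add_le (y (m + d + 1) - y (m + d)) (y (m + d) - y m)
      rw [sub_add_sub_cancel] at h3
      rw [← add_assoc]
      linarith
  refine le_of_forall_pos_le_add fun ε hε => ?_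
  obtain ⟨k, hk, hkε⟩ := hsmall ε hε m
  obtain ⟨d, rfl⟩ := Nat.exists_eq_add_of_le hk
  have h2 := h1 d
  have h3 := abs_sub_abs_le_abs_sub (y m) (y (m + d))
  rw [abs_sub_comm] at h3
  have h4 := mul_nonneg hK (rootWeight_pos (m + d)).le
  linarith

/-- A system asymptotic to `z' = a D / n`, `D' = -b z / n` with `a, b > 0` has no nontrivial
solution that is square-summable with the weight `1 / n`. -/
theorem exists_zero_of_oscillating {z D : ℕ → ℝ} {a b C : ℝ} {n₁ : ℕ} (ha : 0 < a) (hb : 0 < b)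
    (hC : 0 ≤ C)
    (hz : ∀ i ≥ n₁, |z (i + 1) - z i - a * (1 / ((i : ℝ) + 1)) * D i| ≤
      C * (1 / ((i : ℝ) + 1)) ^ 2 * (|z i| + |D i|))
    (hD : ∀ i ≥ n₁, |D (i + 1) - D i + b * (1 / ((i : ℝ) + 1)) * z i| ≤
      C * (1 / ((i : ℝ) + 1)) ^ 2 * (|z i| + |D i|))
    (hzs : Summable fun i : ℕ => 1 / ((i : ℝ) + 1) * z i ^ 2)
    (hDs : Summable fun i : ℕ => 1 / ((i : ℝ) + 1) * D i ^ 2) :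
    ∃ n, z n = 0 ∧ D n = 0 := by
  -- The energy conserved by the limiting system: its first-order cross terms cancel, and the errors
  -- lower it by at most the factor 1 - K/(i+1)².
  let E : ℕ → ℝ := fun i => b * z i ^ 2 + a * D i ^ 2
  set K := 4 * C * (a + b) * (1 / a + 1 / b) with hK
  have hK0 : 0 ≤ K := by positivity
  have hE0 : ∀ i, 0 ≤ E i := fun i => by simp only [E]; positivity
  have hstep : ∀ i ≥ n₁, E i * (1 - K * (1 / ((i : ℝ) + 1)) ^ 2) ≤ E (i + 1) := by
    intro i hi
    have h1 := hz i hi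
    have h2 := hD i hi
    have hbd : (b * |z i| + a * |D i|) * (|z i| + |D i|) ≤
        2 * (a + b) * (1 / a + 1 / b) * E i := by
      have e1 : z i ^ 2 ≤ 1 / b * E i := by
        rw [one_div, ← div_eq_inv_mul, le_div_iff₀ hb]
        simp only [E]
        nlinarith [mul_nonneg ha.le (sq_nonneg (D i))]
      have e2 : D i ^ 2 ≤ 1 / a * E i := by
        rw [one_div, ← div_eq_inv_mul, le_div_iff₀ ha]
        simp only [E]
        nlinarith [mul_nonneg hb.le (sq_nonneg (z i))]
      have e3 : (b * |z i| + a * |D i|) * (|z i| + |D i|) ≤ (a + b) * (|z i| + |D i|) ^ 2 := by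
        have := abs_nonneg (z i)
        have := abs_nonneg (D i)
        have e5 : b * |z i| + a * |D i| ≤ (a + b) * (|z i| + |D i|) := by
          nlinarith [mul_nonneg ha.le (abs_nonneg (z i)), mul_nonneg hb.le (abs_nonneg (D i))]
        calc _ ≤ (a + b) * (|z i| + |D i|) * (|z i| + |D i|) := by gcongr
          _ = _ := by ring
      have e4 : (|z i| + |D i|) ^ 2 ≤ 2 * (z i ^ 2 + D i ^ 2) := by
        rw [← sq_abs (z i), ← sq_abs (D i)]
        nlinarith [sq_nonneg (|z i| - |D i|)]
      calc _ ≤ (a + b) * (2 * (1 / b * E i + 1 / a * E i)) :=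
            e3.trans (by gcongr; linarith)
        _ = _ := by ring
    set h := 1 / ((i : ℝ) + 1)
    set N := |z i| + |D i|
    set e₁ := z (i + 1) - z i - a * h * D i with he₁
    set e₂ := D (i + 1) - D i + b * h * z i with he₂
    have hz' : z (i + 1) = z i + a * h * D i + e₁ := by rw [he₁]; ring
    have hD' : D (i + 1) = D i - b * h * z i + e₂ := by rw [he₂]; ring
    have f1 : -(|z i| * (C * h ^ 2 * N)) ≤ z i * e₁ := by
      have := neg_abs_le (z i * e₁)
      rw [abs_mul] at this
      have := mul_le_mul_of_nonneg_left h1 (abs_nonneg (z i))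
      linarith
    have f2 : -(|D i| * (C * h ^ 2 * N)) ≤ D i * e₂ := by
      have := neg_abs_le (D i * e₂)
      rw [abs_mul] at this
      have := mul_le_mul_of_nonneg_left h2 (abs_nonneg (D i))
      linarith
    have hexp : E (i + 1) = E i + 2 * (b * (z i * e₁)) + 2 * (a * (D i * e₂)) +
        b * (a * h * D i + e₁) ^ 2 + a * (-(b * h * z i) + e₂) ^ 2 := by
      simp only [E]
      rw [hz', hD']
      ring
    have g1 := mul_le_mul_of_nonneg_left f1 hb.le
    have g2 := mul_le_mul_of_nonneg_left f2 ha.le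
    have g3 : 0 ≤ b * (a * h * D i + e₁) ^ 2 := by positivity
    have g4 : 0 ≤ a * (-(b * h * z i) + e₂) ^ 2 := by positivity
    have g5 : 2 * (C * h ^ 2) * ((b * |z i| + a * |D i|) * N) ≤
        2 * (C * h ^ 2) * (2 * (a + b) * (1 / a + 1 / b) * E i) := by gcongr
    have g6 : 2 * (C * h ^ 2) * (2 * (a + b) * (1 / a + 1 / b) * E i) = E i * (K * h ^ 2) := by
      rw [hK]; ring
    rw [hexp]
    linarith
  by_contra! hne
  have hEpos : ∀ i, 0 < E i := fun i => by
    by_cases h : z i = 0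
    · have := hne i h
      simp only [E]
      positivity
    · simp only [E]
      positivity
  obtain ⟨n₀, hn₀⟩ := exists_nat_gt (max (2 * K) n₁)
  have hn₀K : 2 * K < n₀ := (le_max_left _ _).trans_lt hn₀
  have hn₀n : n₁ ≤ n₀ := by exact_mod_cast ((le_max_right _ _).trans_lt hn₀).le
  -- An explicit substitute for the convergent product of the factors 1 - K/(i+1)²: it makes E·g
  -- nondecreasing from n₀ on. Hence E stays bounded below, contradicting the summability of
  -- E/(i+1).
  let g : ℕ → ℝ := fun i => 1 - 2 * K / ((i : ℝ) + 1)
  have hg : ∀ i, n₀ ≤ i → 0 < g i := fun i hi => by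
    have : (n₀ : ℝ) ≤ i := by exact_mod_cast hi
    simp only [g]
    rw [sub_pos, div_lt_one (by positivity)]
    linarith
  have hg1 : ∀ i, g i ≤ 1 := fun i => by
    have : 0 ≤ 2 * K / ((i : ℝ) + 1) := by positivity
    simp only [g]
    linarith
  have hgs : ∀ i, g i ≤ (1 - K * (1 / ((i : ℝ) + 1)) ^ 2) * g (i + 1) := fun i => by
    have e1 : K * (1 / ((i : ℝ) + 1)) ^ 2 * g (i + 1) ≤ K * (1 / ((i : ℝ) + 1)) ^ 2 :=
      mul_le_of_le_one_right (by positivity) (hg1 _)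
    have e2 : K * (1 / ((i : ℝ) + 1)) ^ 2 ≤ g (i + 1) - g i := by
      simp only [g]
      push_cast
      rw [← sub_nonneg]
      have : 1 - 2 * K / ((i : ℝ) + 1 + 1) - (1 - 2 * K / ((i : ℝ) + 1)) -
          K * (1 / ((i : ℝ) + 1)) ^ 2 = K * i / (((i : ℝ) + 1) ^ 2 * (i + 2)) := by
        field_simp
        ring
      rw [this]
      positivity
    linarith
  have hmono : ∀ d, E n₀ * g n₀ ≤ E (n₀ + d) * g (n₀ + d) := fun d => by
    induction d with
    | zero => rfl
    | succ d ih =>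
      refine ih.trans ?_
      calc E (n₀ + d) * g (n₀ + d)
          ≤ E (n₀ + d) * ((1 - K * (1 / (((n₀ + d : ℕ) : ℝ) + 1)) ^ 2) * g (n₀ + d + 1)) :=
            mul_le_mul_of_nonneg_left (hgs _) (hE0 _)
        _ = E (n₀ + d) * (1 - K * (1 / (((n₀ + d : ℕ) : ℝ) + 1)) ^ 2) * g (n₀ + d + 1) := by ring
        _ ≤ E (n₀ + d + 1) * g (n₀ + d + 1) :=
            mul_le_mul_of_nonneg_right (hstep _ (by omega)) (hg _ (by omega)).le
  have hEs : Summable fun i : ℕ => 1 / ((i : ℝ) + 1) * E i := by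
    refine ((hzs.mul_left b).add (hDs.mul_left a)).congr fun i => ?_
    simp only [E]
    ring
  obtain ⟨k, hk, hkE⟩ := exists_lt_of_summable hEs
    (mul_pos (hEpos n₀) (hg n₀ le_rfl)) n₀
  obtain ⟨d, rfl⟩ := Nat.exists_eq_add_of_le hk
  have h1 := hmono d
  have h2 : E (n₀ + d) * g (n₀ + d) ≤ E (n₀ + d) := mul_le_of_le_one_right (hE0 _) (hg1 _)
  linarith

theorem abs_lt_of_sq_summable {y : ℕ → ℝ} (hs : Summable fun i : ℕ => 1 / ((i : ℝ) + 1) * y i ^ 2) :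
    ∀ ε > 0, ∀ n, ∃ k ≥ n, |y k| < ε := fun ε hε n => by
  obtain ⟨k, hk, h⟩ := exists_lt_of_summable hs (pow_pos hε 2) n
  exact ⟨k, hk, abs_lt_of_sq_lt_sq h hε.le⟩

/-- The limiting case `b = 0` of `exists_zero_of_oscillating`. -/
theorem exists_zero_of_threshold {z D : ℕ → ℝ} {a C : ℝ} {n₁ : ℕ} (ha : 0 < a) (hC : 0 ≤ C)
    (hz : ∀ i ≥ n₁, |z (i + 1) - z i - a * (1 / ((i : ℝ) + 1)) * D i| ≤
      C * (1 / ((i : ℝ) + 1)) ^ 2 * (|z i| + |D i|))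
    (hD : ∀ i ≥ n₁, |D (i + 1) - D i| ≤ C * (1 / ((i : ℝ) + 1)) ^ 2 * (|z i| + |D i|))
    (hzs : Summable fun i : ℕ => 1 / ((i : ℝ) + 1) * z i ^ 2)
    (hDs : Summable fun i : ℕ => 1 / ((i : ℝ) + 1) * D i ^ 2) :
    ∃ n, z n = 0 ∧ D n = 0 := by
  by_contra! hne
  let N : ℕ → ℝ := fun i => |z i| + |D i|
  have hNpos : ∀ i, 0 < N i := fun i => by
    by_cases h : z i = 0
    · have := abs_pos.2 (hne i h)
      simp only [N]
      positivity
    · have := abs_pos.2 h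
      simp only [N]
      positivity
  -- No definite energy exists when b = 0. Instead v tends to 0, hence attains a maximum μ beyond
  -- n₀; feeding N ≤ μ√(i+1) into the equations bounds first D and then z by multiples of μ/√(i+1).
  let v : ℕ → ℝ := fun i => rootWeight i * N i
  have hvpos : ∀ i, 0 < v i := fun i => mul_pos (rootWeight_pos i) (hNpos i)
  have hv : Tendsto v atTop (𝓝 0) := by
    have h1 : Tendsto (fun i : ℕ => √(1 / ((i : ℝ) + 1) * z i ^ 2) + √(1 / ((i : ℝ) + 1) * D i ^ 2))
        atTop (𝓝 0) := by
      simpa using hzs.tendsto_atTop_zero.sqrt.add hDs.tendsto_atTop_zero.sqrt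
    refine h1.congr fun i => ?_
    simp only [v, N, ← rootWeight_sq, ← mul_pow, Real.sqrt_sq_eq_abs, abs_mul,
      abs_of_pos (rootWeight_pos i)]
    ring
  set K := 4 * C * (4 * a + 2) with hK
  have hK0 : 0 ≤ K := by positivity
  obtain ⟨n₀, hn₀⟩ := exists_nat_gt (max K n₁)
  have hn₀K : K < n₀ := (le_max_left _ _).trans_lt hn₀
  have hn₀n : n₁ ≤ n₀ := by exact_mod_cast ((le_max_right _ _).trans_lt hn₀).le
  obtain ⟨k₀, hk₀⟩ := eventually_atTop.1 (hv.eventually_lt_const (hvpos n₀))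
  obtain ⟨m, hm, hmax⟩ := Finset.exists_max_image (Finset.Icc n₀ (max n₀ k₀)) v
    ⟨n₀, by simp⟩
  have hm0 : n₀ ≤ m := (Finset.mem_Icc.1 hm).1
  have hmax' : ∀ i ≥ n₀, v i ≤ v m := fun i hi => by
    rcases Nat.lt_or_ge (max n₀ k₀) i with h | h
    · exact (hk₀ i (by omega)).le.trans (hmax n₀ (by simp))
    · exact hmax i (Finset.mem_Icc.2 ⟨hi, h⟩)
  set μ := v m with hμ
  have hμ0 : 0 < μ := hvpos m
  have hNh : ∀ i ≥ n₀, (1 / ((i : ℝ) + 1)) ^ 2 * N i ≤ μ * rootWeight i ^ 3 := fun i hi => by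
    have := mul_le_mul_of_nonneg_right (hmax' i hi) (pow_pos (rootWeight_pos i) 3).le
    refine le_trans (le_of_eq ?_) this
    rw [← rootWeight_sq]
    simp only [v]
    ring
  have hDb : ∀ i ≥ n₀, |D i| ≤ 4 * C * μ * rootWeight i := fun i hi => by
    refine abs_le_of_increments (n₀ := n₀) (fun j hj => ?_) (by positivity)
      (abs_lt_of_sq_summable hDs) hi
    calc |D (j + 1) - D j| ≤ C * ((1 / ((j : ℝ) + 1)) ^ 2 * N j) := by
          rw [← mul_assoc]; exact hD j (by omega)
      _ ≤ C * (μ * rootWeight j ^ 3) := mul_le_mul_of_nonneg_left (hNh j hj) hC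
      _ ≤ C * (μ * (4 * (rootWeight j - rootWeight (j + 1)))) := by
          gcongr; exact rootWeight_cube_le j
      _ = _ := by ring
  have hzb : ∀ i ≥ n₀, |z i| ≤ 4 * C * (4 * a + 1) * μ * rootWeight i := fun i hi => by
    refine abs_le_of_increments (n₀ := n₀) (fun j hj => ?_) (by positivity)
      (abs_lt_of_sq_summable hzs) hi
    have h1 : |z (j + 1) - z j| ≤ |z (j + 1) - z j - a * (1 / ((j : ℝ) + 1)) * D j| +
        |a * (1 / ((j : ℝ) + 1)) * D j| := by
      simpa using abs_add_le (z (j + 1) - z j - a * (1 / ((j : ℝ) + 1)) * D j)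
        (a * (1 / ((j : ℝ) + 1)) * D j)
    have h2 : |a * (1 / ((j : ℝ) + 1)) * D j| ≤ a * (4 * C * μ * rootWeight j ^ 3) := by
      rw [abs_mul, abs_of_nonneg (by positivity), ← rootWeight_sq]
      calc a * rootWeight j ^ 2 * |D j| ≤ a * rootWeight j ^ 2 * (4 * C * μ * rootWeight j) := by
            gcongr; exact hDb j hj
        _ = _ := by ring
    have h3 := hz j (by omega)
    have h4 := mul_le_mul_of_nonneg_left (hNh j hj) hC
    have h5 := mul_le_mul_of_nonneg_left (rootWeight_cube_le j)
      (show 0 ≤ C * (4 * a + 1) * μ by positivity)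
    rw [mul_assoc C] at h3
    change _ ≤ C * ((1 / ((j : ℝ) + 1)) ^ 2 * N j) at h3
    linarith
  have hfin : N m ≤ K * μ * rootWeight m := by
    have h1 := hDb m hm0
    have h2 := hzb m hm0
    simp only [N]
    rw [hK]
    linarith
  -- At the maximizing index m the improved bounds give m + 1 ≤ K, whereas K < n₀ ≤ m.
  have h1 : μ ≤ K * μ * (1 / ((m : ℝ) + 1)) := by
    have h2 := mul_le_mul_of_nonneg_left hfin (rootWeight_pos m).le
    calc μ = rootWeight m * N m := hμ
      _ ≤ _ := h2
      _ = _ := by rw [← rootWeight_sq]; ring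
  rw [mul_one_div, le_div_iff₀ (by positivity)] at h1
  have h2 : (n₀ : ℝ) ≤ m := by exact_mod_cast hm0
  have h3 : (m : ℝ) + 1 ≤ K := by nlinarith
  linarith

/-! ### The difference relation for the rescaled image -/

theorem map_re_smul (φ : ℂ →L[ℝ] ℝ) (r : ℝ) (w : ℂ) : φ ((r : ℂ) * w) = r * φ w := by
  rw [← Complex.real_smul, map_smul, smul_eq_mul]

/-- The rescaled real sequence `√n φ((K_α x)(n))`. -/
noncomputable def scaledImage (α : ℝ) (x : EllTwo) (φ : ℂ →L[ℝ] ℝ) (i : ℕ) : ℝ :=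
  √((i : ℝ) + 1) * φ (coord (hardyOp α x) i)

theorem hasSum_scaledImage {α : ℝ} (hα : 0 < α) (x : EllTwo) (φ : ℂ →L[ℝ] ℝ) (i : ℕ) :
    HasSum (fun j => ratioKernel α i j * scaled (fun i => φ (coord x i)) j)
      (scaledImage α x φ i) := by
  have h := (φ.hasSum (summable_coord_hardyOp hα x i).hasSum).mul_left √((i : ℝ) + 1)
  rw [← coord_hardyOp hα] at h
  refine h.congr_fun fun j => ?_
  simp only [map_re_smul, scaled]
  rw [entry_eq]
  field_simp

/-- The first order difference relation between `√n (K_α x)(n)` and the lower sums. -/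
theorem scaledImage_sub {α : ℝ} (hα : 0 < α) (x : EllTwo) (φ : ℂ →L[ℝ] ℝ) (i : ℕ) :
    scaledImage α x φ i - stepRatio α i * scaledImage α x φ (i + 1) =
      (1 - stepRatio α i ^ 2) * lowerSum α (scaled fun i => φ (coord x i)) i := by
  have h := (hasSum_scaledImage hα x φ i).sub
    ((hasSum_scaledImage hα x φ (i + 1)).mul_left (stepRatio α i))
  rw [lowerSum_eq, Finset.mul_sum]
  -- For j > i the kernel at row i is ρ_i times the kernel at row i+1, so the upper tails cancel and
  -- a finite sum is left.
  have h2 : ∀ j ∉ Finset.range (i + 1),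
      ratioKernel α i j * scaled (fun i => φ (coord x i)) j -
        stepRatio α i * (ratioKernel α (i + 1) j * scaled (fun i => φ (coord x i)) j) = 0 := by
    intro j hj
    rw [ratioKernel_eq_mul_succ α (by simpa using hj)]
    ring
  rw [h.unique (hasSum_sum_of_ne_finset_zero h2)]
  refine Finset.sum_congr rfl fun j hj => ?_
  rw [ratioKernel_succ α (by simpa [Nat.lt_succ_iff] using hj)]
  ring

theorem scaledImage_succ {α : ℝ} (hα : 0 < α) (x : EllTwo) (φ : ℂ →L[ℝ] ℝ) (i : ℕ) :
    scaledImage α x φ (i + 1) = (stepRatio α i)⁻¹ * scaledImage α x φ i -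
      ((stepRatio α i)⁻¹ - stepRatio α i) * lowerSum α (scaled fun i => φ (coord x i)) i := by
  have h := scaledImage_sub hα x φ i
  have h0 := (stepRatio_pos α i).ne'
  field_simp
  linarith

theorem sum_lowerSum_le_quadForm {α : ℝ} (hα : 0 < α) (x : EllTwo) (M : ℕ) :
    ∑ k ∈ Finset.range M, (1 - stepRatio α k ^ 2) *
        lowerSum α (scaled fun i => (coord x i).re) k ^ 2 +
      ∑ k ∈ Finset.range M, (1 - stepRatio α k ^ 2) *
        lowerSum α (scaled fun i => (coord x i).im) k ^ 2 ≤ quadForm (hardyOp α) x := by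
  refine ge_of_tendsto (tendsto_realForm hα x) ((eventually_ge_atTop (M + 1)).mono fun L hL => ?_)
  obtain ⟨d, rfl⟩ := Nat.exists_eq_add_of_le hL
  have h : ∀ u : ℕ → ℝ, ∑ k ∈ Finset.range M, (1 - stepRatio α k ^ 2) *
        lowerSum α (scaled u) k ^ 2 ≤ realForm α u (M + 1 + d) := fun u => by
    have e : M + 1 + d = M + d + 1 := by ring
    rw [e]
    refine le_trans ?_ (sum_le_realForm u)
    exact Finset.sum_le_sum_of_subset_of_nonneg (Finset.range_mono (by omega))
      fun i _ _ => mul_nonneg (one_sub_stepRatio_sq_pos hα i).le (sq_nonneg _)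
  exact add_le_add (h _) (h _)

/-- `φ` is the real part or the imaginary part. -/
def IsCoordinate (φ : ℂ →L[ℝ] ℝ) : Prop := φ = Complex.reCLM ∨ φ = Complex.imCLM

/-- The sum of squares is bounded by the form at x, and its weights 1 - ρ_i² are at least α/(i+2+α),
which is comparable to 1/(i+1). -/
theorem summable_lowerSum_sq {α : ℝ} (hα : 0 < α) (x : EllTwo) {φ : ℂ →L[ℝ] ℝ}
    (hφ : IsCoordinate φ) : Summable fun i : ℕ => 1 / ((i : ℝ) + 1) *
      lowerSum α (scaled fun i => φ (coord x i)) i ^ 2 := by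
  have hnn : ∀ (u : ℕ → ℝ) (M : ℕ), 0 ≤ ∑ k ∈ Finset.range M, (1 - stepRatio α k ^ 2) *
        lowerSum α (scaled u) k ^ 2 := fun u M =>
    Finset.sum_nonneg fun i _ => mul_nonneg (one_sub_stepRatio_sq_pos hα i).le (sq_nonneg _)
  have hs : Summable fun i => (1 - stepRatio α i ^ 2) *
      lowerSum α (scaled fun i => φ (coord x i)) i ^ 2 := by
    refine summable_of_sum_range_le (c := quadForm (hardyOp α) x)
      (fun i => mul_nonneg (one_sub_stepRatio_sq_pos hα i).le (sq_nonneg _)) fun M => ?_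
    have h := sum_lowerSum_le_quadForm hα x M
    rcases hφ with rfl | rfl
    · exact (le_add_of_nonneg_right (hnn _ M)).trans h
    · exact (le_add_of_nonneg_left (hnn _ M)).trans h
  refine (hs.mul_left ((2 + α) / α)).of_nonneg_of_le (fun i => by positivity) fun i => ?_
  rw [← mul_assoc]
  refine mul_le_mul_of_nonneg_right ?_ (sq_nonneg _)
  have h1 := one_add_le_inv_stepRatio hα i
  have h2 := stepRatio_pos α i
  have h3 := stepRatio_lt_one hα i
  rw [le_inv_comm₀ (by positivity) h2] at h1
  have h4 : (1 + α / ((i : ℝ) + 2))⁻¹ = 1 - α / (i + 2 + α) := by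
    field_simp
    ring
  have h5 : α / ((i : ℝ) + 2 + α) ≤ 1 - stepRatio α i ^ 2 := by nlinarith
  calc 1 / ((i : ℝ) + 1) ≤ (2 + α) / α * (α / (i + 2 + α)) := by
        rw [div_mul_div_comm, div_le_div_iff₀ (by positivity) (by positivity)]
        have : (0 : ℝ) ≤ i := by positivity
        nlinarith [mul_nonneg hα.le this, mul_nonneg (mul_nonneg hα.le this) hα.le]
    _ ≤ _ := by gcongr

theorem scaledImage_sq {α : ℝ} (x : EllTwo) (φ : ℂ →L[ℝ] ℝ) (i : ℕ) :
    1 / ((i : ℝ) + 1) * scaledImage α x φ i ^ 2 = φ (coord (hardyOp α x) i) ^ 2 := by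
  rw [scaledImage, mul_pow, Real.sq_sqrt (by positivity)]
  field_simp

theorem summable_scaledImage_sq {α : ℝ} (x : EllTwo) {φ : ℂ →L[ℝ] ℝ} (hφ : IsCoordinate φ) :
    Summable fun i : ℕ => 1 / ((i : ℝ) + 1) * scaledImage α x φ i ^ 2 := by
  simp only [scaledImage_sq]
  refine (hasSum_coord_sq (hardyOp α x)).summable.of_nonneg_of_le (fun i => sq_nonneg _) fun i => ?_
  rw [← sq_abs]
  gcongr
  rcases hφ with rfl | rfl
  exacts [Complex.abs_re_le_norm _, Complex.abs_im_le_norm _]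

/-! ### Eigenvectors -/

section Eigenvector

variable {α lam : ℝ} {x : EllTwo}

theorem scaled_coord_eq (hlam : lam ≠ 0) (hx : hardyOp α x = (lam : ℂ) • x) (φ : ℂ →L[ℝ] ℝ)
    (i : ℕ) : scaled (fun i => φ (coord x i)) i =
      scaledImage α x φ i / (lam * ((i : ℝ) + 1)) := by
  have h : coord (hardyOp α x) i = (lam : ℂ) * coord x i := by
    rw [hx]; rfl
  rw [scaledImage, scaled, h, map_re_smul]
  have h2 : √((i : ℝ) + 1) * √((i : ℝ) + 1) = (i : ℝ) + 1 := Real.mul_self_sqrt (by positivity)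
  rw [div_eq_div_iff (Real.sqrt_ne_zero'.2 (by positivity)) (by positivity)]
  linear_combination (-lam * φ (coord x i)) * h2

theorem coordinate_eq_zero_of_scaledImage (hlam : lam ≠ 0) (hx : hardyOp α x = (lam : ℂ) • x)
    {φ : ℂ →L[ℝ] ℝ} {i : ℕ} (h : scaledImage α x φ i = 0) : φ (coord x i) = 0 := by
  have h2 := scaled_coord_eq hlam hx φ i
  rw [h, zero_div, scaled] at h2
  exact (div_eq_zero_iff.1 h2).resolve_right (Real.sqrt_ne_zero'.2 (by positivity))

/-- For an eigenvector the pair (z, P) obeys a homogeneous two-term recursion whose initial P is a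
multiple of z_0. The whole sequence is thus determined by z_0, which also yields simplicity. -/
theorem scaledImage_eq_zero_of_zero (hα : 0 < α) (hlam : lam ≠ 0)
    (hx : hardyOp α x = (lam : ℂ) • x) {φ : ℂ →L[ℝ] ℝ} (h : scaledImage α x φ 0 = 0) (i : ℕ) :
    scaledImage α x φ i = 0 ∧ lowerSum α (scaled fun i => φ (coord x i)) i = 0 := by
  induction i with
  | zero =>
    refine ⟨h, ?_⟩
    rw [lowerSum, scaled_coord_eq hlam hx, h, zero_div]
  | succ i ih =>
    have h1 : scaledImage α x φ (i + 1) = 0 := by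
      rw [scaledImage_succ hα, ih.1, ih.2]; ring
    refine ⟨h1, ?_⟩
    rw [lowerSum, ih.2, scaled_coord_eq hlam hx, h1, zero_div]
    ring

/-- The recursion for (z, P) can also be run backwards because the step ratios are nonzero. -/
theorem scaledImage_zero_eq_zero (hα : 0 < α) (hlam : lam ≠ 0)
    (hx : hardyOp α x = (lam : ℂ) • x) {φ : ℂ →L[ℝ] ℝ} {n : ℕ} (h : scaledImage α x φ n = 0)
    (hP : lowerSum α (scaled fun i => φ (coord x i)) n = 0) : scaledImage α x φ 0 = 0 := by
  induction n with
  | zero => exact h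
  | succ n ih =>
    rw [lowerSum, scaled_coord_eq hlam hx, h, zero_div, add_zero] at hP
    have hP' := (mul_eq_zero.1 hP).resolve_left (stepRatio_pos α n).ne'
    have h2 := scaledImage_sub hα x φ n
    rw [h, hP', mul_zero, mul_zero, sub_zero] at h2
    exact ih h2 hP'

/-- To first order z changes by α(z - 2P)/n and P by (z/λ - αP)/n; the combination D = z - 2P makes
the leading matrix of the system antidiagonal. The lower limit ⌈α⌉ makes the expansions of the step
ratio available. -/
theorem eigenvector_increments (hα : 0 < α) (hlam : 0 < lam) (hx : hardyOp α x = (lam : ℂ) • x)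
    (φ : ℂ →L[ℝ] ℝ) : ∃ C : ℝ, 0 ≤ C ∧ ∃ n₁ : ℕ, ∀ i ≥ n₁,
      let z := scaledImage α x φ
      let D := fun i => z i - 2 * lowerSum α (scaled fun i => φ (coord x i)) i
      |z (i + 1) - z i - α * (1 / ((i : ℝ) + 1)) * D i| ≤
          C * (1 / ((i : ℝ) + 1)) ^ 2 * (|z i| + |D i|) ∧
        |D (i + 1) - D i + (2 / lam - α) * (1 / ((i : ℝ) + 1)) * z i| ≤
          C * (1 / ((i : ℝ) + 1)) ^ 2 * (|z i| + |D i|) := by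
  set C₀ := expansionConst α with hC₀
  have hC₀0 : 0 < C₀ := expansionConst_pos hα
  set κ := 2 / lam with hκ
  have hκ0 : 0 < κ := by positivity
  -- C₀ bounds the remainders of ρ and ρ⁻¹. The κ term pays for replacing z(i+1)/(i+2) by
  -- z(i)/(i+1).
  refine ⟨C₀ + κ * (1 + 2 * α + 2 * C₀), by positivity, ⌈α⌉₊, fun i hi => ?_⟩
  intro z D
  have hαi : α ≤ (i : ℝ) + 1 := by
    have h1 : (⌈α⌉₊ : ℝ) ≤ i := by exact_mod_cast hi
    linarith [Nat.le_ceil α]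
  obtain ⟨hr₁, hr₂⟩ := abs_stepRatio_sub_le hα hαi
  have hz' : z (i + 1) = (stepRatio α i)⁻¹ * z i - ((stepRatio α i)⁻¹ - stepRatio α i) *
      lowerSum α (scaled fun i => φ (coord x i)) i := scaledImage_succ hα x φ i
  have hP' : lowerSum α (scaled fun i => φ (coord x i)) (i + 1) =
      stepRatio α i * lowerSum α (scaled fun i => φ (coord x i)) i +
        κ / 2 * (1 / ((i : ℝ) + 2)) * z (i + 1) := by
    rw [lowerSum, scaled_coord_eq hlam.ne' hx, hκ]
    have hlam' := hlam.ne'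
    push_cast
    simp only [z]
    field_simp
    ring
  have hDdef : ∀ i, D i = z i - 2 * lowerSum α (scaled fun i => φ (coord x i)) i := fun i => rfl
  have hDi : lowerSum α (scaled fun i => φ (coord x i)) i = (z i - D i) / 2 := by
    rw [hDdef]; ring
  have hD' := hDdef (i + 1)
  rw [hP', hDi] at hD'
  rw [hDi] at hz'
  have hhi : |1 / ((i : ℝ) + 1) - 1 / (i + 2)| ≤ (1 / ((i : ℝ) + 1)) ^ 2 := by
    have e : 1 / ((i : ℝ) + 1) - 1 / (i + 2) = 1 / ((i + 1) * (i + 2)) := by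
      field_simp
      ring
    rw [e, abs_of_nonneg (by positivity), div_pow, one_pow, sq]
    gcongr
    linarith
  have hh1 : 1 / ((i : ℝ) + 1) ≤ 1 := by
    rw [div_le_one (by positivity)]
    linarith [show (0 : ℝ) ≤ i by positivity]
  set h := 1 / ((i : ℝ) + 1) with hh
  have hh0 : 0 < h := by positivity
  set k := 1 / ((i : ℝ) + 2)
  set ρ := stepRatio α i
  set r₁ := ρ - 1 + α * h with hr₁d
  set r₂ := ρ⁻¹ - 1 - α * h with hr₂d
  have hcomb : ∀ a b : ℝ, |1 / 2 * (r₁ + r₂) * a| ≤ C₀ * h ^ 2 * |a| ∧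
      |1 / 2 * (r₂ - r₁) * b| ≤ C₀ * h ^ 2 * |b| := fun a b => by
    rw [abs_le] at hr₁ hr₂
    constructor
    · rw [abs_mul]
      gcongr
      rw [abs_le]; constructor <;> linarith
    · rw [abs_mul]
      gcongr
      rw [abs_le]; constructor <;> linarith
  have hz1 : |z (i + 1) - z i - α * h * D i| ≤ C₀ * h ^ 2 * (|z i| + |D i|) := by
    have e : z (i + 1) - z i - α * h * D i =
        1 / 2 * (r₁ + r₂) * z i + 1 / 2 * (r₂ - r₁) * D i := by
      rw [hz', hr₁d, hr₂d]; ring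
    rw [e]
    exact ((abs_add_le _ _).trans (add_le_add (hcomb (z i) 0).1 (hcomb 0 (D i)).2)).trans_eq
      (by ring)
  set N := |z i| + |D i| with hN
  have hN0 : 0 ≤ N := by positivity
  have hDN : |D i| ≤ N := by rw [hN]; linarith [abs_nonneg (z i)]
  have hzN : |z i| ≤ N := by rw [hN]; linarith [abs_nonneg (D i)]
  have hdz : |z i - z (i + 1)| ≤ (α + C₀) * h * N := by
    have e := abs_add_le (z (i + 1) - z i - α * h * D i) (α * h * D i)
    rw [sub_add_cancel] at e
    rw [abs_sub_comm]
    have e2 : |α * h * D i| ≤ α * h * N := by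
      rw [abs_mul, abs_of_pos (by positivity)]; gcongr
    have e3 : C₀ * h ^ 2 * N ≤ C₀ * h * N := by
      have : h ^ 2 ≤ h := by nlinarith
      gcongr
    linarith
  have hzabs : |z (i + 1)| ≤ (1 + α + C₀) * N := by
    have e := abs_sub_abs_le_abs_sub (z (i + 1)) (z i)
    rw [abs_sub_comm] at e
    have e2 : (α + C₀) * h * N ≤ (α + C₀) * N :=
      mul_le_mul_of_nonneg_right (mul_le_of_le_one_right (by positivity) hh1) hN0
    linarith
  have hC : C₀ * h ^ 2 * N ≤ (C₀ + κ * (1 + 2 * α + 2 * C₀)) * h ^ 2 * N := by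
    gcongr
    exact le_add_of_nonneg_right (by positivity)
  refine ⟨hz1.trans hC, ?_⟩
  have e : D (i + 1) - D i + (κ - α) * h * z i =
      1 / 2 * (r₂ - r₁) * z i + 1 / 2 * (r₁ + r₂) * D i +
        κ * ((h - k) * z (i + 1) + h * (z i - z (i + 1))) := by
    have e2 : z (i + 1) - ρ * (z i - D i) - D i - α * h * z i =
        1 / 2 * (r₂ - r₁) * z i + 1 / 2 * (r₁ + r₂) * D i := by
      rw [hz', hr₁d, hr₂d]; ring
    rw [← e2, hD']
    ring
  have e3 : |κ * ((h - k) * z (i + 1) + h * (z i - z (i + 1)))| ≤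
      κ * (1 + 2 * α + 2 * C₀) * h ^ 2 * N := by
    rw [abs_mul, abs_of_pos hκ0]
    have f1 : |(h - k) * z (i + 1)| ≤ h ^ 2 * ((1 + α + C₀) * N) := by
      rw [abs_mul]; gcongr
    have f2 : |h * (z i - z (i + 1))| ≤ h * ((α + C₀) * h * N) := by
      rw [abs_mul, abs_of_pos hh0]; gcongr
    calc _ ≤ κ * (h ^ 2 * ((1 + α + C₀) * N) + h * ((α + C₀) * h * N)) := by
          gcongr; exact (abs_add_le _ _).trans (add_le_add f1 f2)
      _ = _ := by ring
  rw [e]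
  have e4 := abs_add_le (1 / 2 * (r₂ - r₁) * z i + 1 / 2 * (r₁ + r₂) * D i)
    (κ * ((h - k) * z (i + 1) + h * (z i - z (i + 1))))
  have e5 := abs_add_le (1 / 2 * (r₂ - r₁) * z i) (1 / 2 * (r₁ + r₂) * D i)
  have e6 := (hcomb 0 (z i)).2
  have e7 := (hcomb (D i) 0).1
  have e8 : C₀ * h ^ 2 * N = C₀ * h ^ 2 * |z i| + C₀ * h ^ 2 * |D i| := by rw [hN]; ring
  linarith

/-- The condition λ ≤ 2/α says b = 2/λ - α ≥ 0, so the oscillating or the threshold lemma gives an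
index where z and D both vanish. The recursion then carries this zero back to the start and on to
every index. -/
theorem coordinate_eq_zero_of_le (hα : 0 < α) (hlam : 0 < lam) (hle : lam ≤ 2 / α)
    (hx : hardyOp α x = (lam : ℂ) • x) {φ : ℂ →L[ℝ] ℝ} (hφ : IsCoordinate φ) (i : ℕ) :
    φ (coord x i) = 0 := by
  obtain ⟨C, hC, n₁, h⟩ := eigenvector_increments hα hlam hx φ
  have hzs := summable_scaledImage_sq (α := α) x hφ
  have hPs := summable_lowerSum_sq hα x hφ
  have hDs : Summable fun i : ℕ => 1 / ((i : ℝ) + 1) * (scaledImage α x φ i -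
      2 * lowerSum α (scaled fun i => φ (coord x i)) i) ^ 2 := by
    refine ((hzs.mul_left 2).add (hPs.mul_left 8)).of_nonneg_of_le (fun i => by positivity)
      fun i => ?_
    have h1 : (0 : ℝ) < 1 / ((i : ℝ) + 1) := by positivity
    have h2 := mul_nonneg h1.le (sq_nonneg (scaledImage α x φ i +
      2 * lowerSum α (scaled fun i => φ (coord x i)) i))
    linarith
  have hb : 0 ≤ 2 / lam - α := by
    rw [le_div_iff₀ hα] at hle
    rw [sub_nonneg, le_div_iff₀ hlam]
    linarith
  obtain ⟨n, hn, hDn⟩ : ∃ n, scaledImage α x φ n = 0 ∧ scaledImage α x φ n -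
      2 * lowerSum α (scaled fun i => φ (coord x i)) n = 0 := by
    rcases hb.eq_or_lt with hb | hb
    · exact exists_zero_of_threshold (n₁ := n₁) hα hC (fun i hi => (h i hi).1)
        (fun i hi => by simpa [← hb] using (h i hi).2) hzs hDs
    · exact exists_zero_of_oscillating (n₁ := n₁) hα hb hC (fun i hi => (h i hi).1)
        (fun i hi => (h i hi).2) hzs hDs
  have hP : lowerSum α (scaled fun i => φ (coord x i)) n = 0 := by linarith
  exact coordinate_eq_zero_of_scaledImage hlam.ne' hx
    (scaledImage_eq_zero_of_zero hα hlam.ne' hx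
      (scaledImage_zero_eq_zero hα hlam.ne' hx hn hP) i).1

end Eigenvector

/-! ### Location and simplicity of the eigenvalues -/

theorem eq_zero_of_coordinates {x : EllTwo}
    (h : ∀ φ : ℂ →L[ℝ] ℝ, IsCoordinate φ → ∀ i, φ (coord x i) = 0) : x = 0 :=
  ext_coord fun i => Complex.ext (h _ (Or.inl rfl) i) (h _ (Or.inr rfl) i)

theorem im_eq_zero_of_hasEigenvalue {α : ℝ} (hα : 0 < α) {μ : ℂ}
    (hμ : Module.End.HasEigenvalue (hardyOp α : Module.End ℂ EllTwo) μ) : μ.im = 0 :=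
  Complex.conj_eq_iff_im.1 ((isSymmetric_hardyOp hα).conj_eigenvalue_eq_self hμ)

theorem two_div_lt_of_mem_eigenvalueSet {α : ℝ} (hα : 0 < α) {μ : ℝ}
    (hμ : μ ∈ eigenvalueSet (hardyOp α)) : 2 / α < μ := by
  obtain ⟨v, hv⟩ := Module.End.HasEigenvalue.exists_hasEigenvector hμ
  have hv' : hardyOp α v = (μ : ℂ) • v := hv.apply_eq_smul
  have hpos := quadForm_hardyOp_pos hα hv.2
  rw [quadForm_smul_self hv'] at hpos
  have hμ0 : 0 < μ := pos_of_mul_pos_left hpos (sq_nonneg _)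
  by_contra! hle
  exact hv.2 (eq_zero_of_coordinates fun φ hφ i => coordinate_eq_zero_of_le hα hμ0 hle hv' hφ i)

theorem finrank_eigenspace_hardyOp {α : ℝ} (hα : 0 < α) {μ : ℝ}
    (hμ : μ ∈ eigenvalueSet (hardyOp α)) :
    Module.finrank ℂ (Module.End.eigenspace (hardyOp α : Module.End ℂ EllTwo) (μ : ℂ)) = 1 := by
  have hμ0 : μ ≠ 0 :=
    ((show (0 : ℝ) < 2 / α by positivity).trans (two_div_lt_of_mem_eigenvalueSet hα hμ)).ne'
  set E := Module.End.eigenspace (hardyOp α : Module.End ℂ EllTwo) (μ : ℂ)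
  let f : E →ₗ[ℂ] ℂ :=
    { toFun := fun v => coord v 0
      map_add' := fun _ _ => rfl
      map_smul' := fun _ _ => rfl }
  have hf : Function.Injective f := by
    rw [injective_iff_map_eq_zero]
    intro v hv
    have hv' : hardyOp α v = (μ : ℂ) • (v : EllTwo) := Module.End.mem_eigenspace_iff.1 v.2
    have hv0 : coord v 0 = 0 := hv
    refine Subtype.ext (eq_zero_of_coordinates fun φ _ i =>
      coordinate_eq_zero_of_scaledImage hμ0 hv' (scaledImage_eq_zero_of_zero hα hμ0 hv' ?_ i).1)
    have h : coord (hardyOp α v) 0 = (μ : ℂ) * coord v 0 := by rw [hv']; rfl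
    rw [scaledImage, h, hv0, mul_zero, map_zero, mul_zero]
  have hfd : FiniteDimensional ℂ E := FiniteDimensional.of_injective f hf
  have h1 : Module.finrank ℂ E ≤ 1 := by
    simpa using LinearMap.finrank_le_finrank_of_injective hf
  have h2 : 0 < Module.finrank ℂ E := by
    have : Nontrivial E := (Submodule.nontrivial_iff_ne_bot).2 hμ
    exact Module.finrank_pos
  omega

/-! ### Finiteness of the set of eigenvalues -/

/-- One step of a Hardy inequality in the time log n with the test function n^(-1/2): up to
telescoping terms, n(z_n - z_(n+1))² controls a multiple of n^(-3/2) z². This gain is larger than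
errors of order n⁻². -/
theorem hardy_step {k : ℕ} (hk : rootWeight k ≤ 1 / 8) (z z' : ℝ) :
    (rootWeight (k + 1) + rootWeight (k + 1) ^ 3 / 8) * z' ^ 2 - rootWeight k * z ^ 2 ≤
      ((k : ℝ) + 1) * (z - z') ^ 2 := by
  have hs := rootWeight_pos k
  have hs' := rootWeight_pos (k + 1)
  have hw : ((k : ℝ) + 1) = 1 / rootWeight k ^ 2 := by rw [rootWeight_sq]; field_simp
  have h1 := rootWeight_cube_le k
  have h2 := rootWeight_succ_le k
  rw [hw]
  set s := rootWeight k
  set t := rootWeight (k + 1)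
  have h3 : t ^ 3 ≤ s ^ 3 := by gcongr
  have h4 : s ^ 4 ≤ s ^ 3 / 8 := by nlinarith [pow_pos hs 3]
  have h5 : t + t ^ 3 / 8 ≤ s - s ^ 4 := by linarith
  have h6 : (s - s ^ 4) * z' ^ 2 - s * z ^ 2 ≤ 1 / s ^ 2 * (z - z') ^ 2 := by
    rw [one_div, inv_mul_eq_div, le_div_iff₀ (by positivity)]
    have h8 : (z - z') ^ 2 - ((s - s ^ 4) * z' ^ 2 - s * z ^ 2) * s ^ 2 =
        ((1 + s ^ 3) * z - z') ^ 2 / (1 + s ^ 3) + s ^ 9 / (1 + s ^ 3) * z' ^ 2 := by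
      field_simp
      ring
    have h9 : 0 ≤ ((1 + s ^ 3) * z - z') ^ 2 / (1 + s ^ 3) + s ^ 9 / (1 + s ^ 3) * z' ^ 2 := by
      positivity
    linarith
  nlinarith [mul_le_mul_of_nonneg_right h5 (sq_nonneg z')]

/-- The coefficient of the boundary term in `storage_step`. -/
noncomputable def boundaryCoeff (α : ℝ) (k : ℕ) : ℝ :=
  1 / 2 - α / 4 * (1 / ((k : ℝ) + 1)) + expansionConst α * (1 / ((k : ℝ) + 1)) ^ 2 -
    (rootWeight k + rootWeight k ^ 3 / 8) / (4 * α)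

theorem boundaryCoeff_le {α : ℝ} (hα : 0 < α) (k : ℕ) :
    boundaryCoeff α k ≤ 1 / 2 + expansionConst α := by
  have h1 : 1 / ((k : ℝ) + 1) ≤ 1 := by
    rw [div_le_one (by positivity)]
    linarith [show (0 : ℝ) ≤ k by positivity]
  have h0 : 0 < 1 / ((k : ℝ) + 1) := by positivity
  have h2 : expansionConst α * (1 / ((k : ℝ) + 1)) ^ 2 ≤ expansionConst α :=
    mul_le_of_le_one_right (expansionConst_pos hα).le (pow_le_one₀ h0.le h1)
  have h3 : 0 ≤ (rootWeight k + rootWeight k ^ 3 / 8) / (4 * α) := by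
    have := rootWeight_pos k
    positivity
  have h4 : 0 ≤ α / 4 * (1 / ((k : ℝ) + 1)) := by positivity
  unfold boundaryCoeff
  linarith

theorem exists_storage_step {α : ℝ} (hα : 0 < α) : ∃ k₀ : ℕ, ∀ k ≥ k₀, ∀ z z' P : ℝ,
    z - stepRatio α k * z' = (1 - stepRatio α k ^ 2) * P →
      α / 2 * (1 / ((k : ℝ) + 1) * z ^ 2) + boundaryCoeff α k * z ^ 2 -
        boundaryCoeff α (k + 1) * z' ^ 2 ≤ (1 - stepRatio α k ^ 2) * P ^ 2 := by
  have hC := expansionConst_pos hα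
  -- The threshold 1/8 serves `hardy_step`; the threshold 1/(40αC) lets the Hardy gain absorb the
  -- error (5/4)C/(k+1)²; and 2α ≤ k keeps the step ratio at least 1/2.
  have h8 : ∀ᶠ k in atTop, rootWeight k < 1 / 8 := tendsto_rootWeight.eventually_lt_const (by norm_num)
  have hsm : ∀ᶠ k in atTop, rootWeight k < 1 / (40 * α * expansionConst α) :=
    tendsto_rootWeight.eventually_lt_const (by positivity)
  have hlg : ∀ᶠ k : ℕ in atTop, 2 * α ≤ k := by
    filter_upwards [eventually_ge_atTop ⌈2 * α⌉₊] with k hk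
    exact (Nat.le_ceil _).trans (by exact_mod_cast hk)
  obtain ⟨k₀, hk₀⟩ := eventually_atTop.1 (h8.and (hsm.and hlg))
  refine ⟨k₀, fun k hk z z' P hP => ?_⟩
  obtain ⟨g8, gsm, glg⟩ := hk₀ k hk
  have hρ0 := stepRatio_pos α k
  have hρ1 := stepRatio_lt_one hα k
  have hρ2 := one_sub_stepRatio_sq_pos hα k
  have hup := one_sub_stepRatio_le hα k
  have hlo := (abs_le.1 (abs_stepRatio_sub_le hα (i := k) (by linarith)).1).2
  have hhardy := hardy_step g8.le z z'
  have hs := rootWeight_pos k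
  have hsq := rootWeight_sq k
  have hh' : 1 / (((k + 1 : ℕ) : ℝ) + 1) ≤ 1 / ((k : ℝ) + 1) := by
    push_cast; gcongr; linarith
  have hh2 : 1 / ((k : ℝ) + 1) ≤ 2 * (1 / (((k + 1 : ℕ) : ℝ) + 1)) := by
    push_cast
    rw [mul_one_div, div_le_div_iff₀ (by positivity) (by positivity)]
    linarith [show (0 : ℝ) ≤ k by positivity]
  have hαh : α * (1 / ((k : ℝ) + 1)) ≤ 1 / 2 := by
    rw [mul_one_div, div_le_iff₀ (by positivity)]; linarith
  have hk1 : (k : ℝ) + 1 = 1 / (1 / ((k : ℝ) + 1)) := by rw [one_div_one_div]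
  unfold boundaryCoeff
  rw [hk1] at hhardy
  set h := 1 / ((k : ℝ) + 1) with hh
  set h' := 1 / (((k + 1 : ℕ) : ℝ) + 1)
  set ρ := stepRatio α k
  set s := rootWeight k
  set t := rootWeight (k + 1)
  set C := expansionConst α
  have hh0 : 0 < h := by positivity
  have hh'0 : 0 < h' := by positivity
  -- The square splits into a difference term, of which half its asymptotic size is spent on the
  -- Hardy inequality, and boundary terms with 1/(1+ρ) ≈ 1/2 + αh/4 and ρ/(1+ρ) ≈ 1/2 - αh/4. These
  -- telescope and leave (α/2)h z².
  have e : (1 - ρ ^ 2) * P ^ 2 =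
      ρ / (1 - ρ ^ 2) * (z - z') ^ 2 + 1 / (1 + ρ) * z ^ 2 - ρ / (1 + ρ) * z' ^ 2 := by
    have hP' : P = (z - ρ * z') / (1 - ρ ^ 2) := by rw [hP]; field_simp
    have h1ρ : 1 - ρ ≠ 0 := by linarith
    have h1ρ' : 1 + ρ ≠ 0 := by positivity
    have hf : 1 - ρ ^ 2 = (1 - ρ) * (1 + ρ) := by ring
    rw [hP', hf]
    field_simp
    ring
  have b1 : 1 / (4 * α) * (1 / h) ≤ ρ / (1 - ρ ^ 2) := by
    rw [div_mul_div_comm, one_mul, div_le_div_iff₀ (by positivity) hρ2]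
    nlinarith [mul_pos hα hh0]
  have b2 : 1 / 2 + (α * h - C * h ^ 2) / 4 ≤ 1 / (1 + ρ) := by
    rw [le_div_iff₀ (by positivity)]
    nlinarith [sq_nonneg (1 - ρ)]
  have b3 : ρ / (1 + ρ) ≤ 1 / 2 - α / 4 * h' + C * h' ^ 2 := by
    have b4 : ρ / (1 + ρ) = 1 - 1 / (1 + ρ) := by field_simp; ring
    have b5 : h ^ 2 ≤ 4 * h' ^ 2 := by nlinarith
    have b6 := mul_le_mul_of_nonneg_left b5 hC.le
    have b7 := mul_le_mul_of_nonneg_left hh' hα.le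
    rw [b4]
    linarith
  have c1 := mul_le_mul_of_nonneg_right b1 (sq_nonneg (z - z'))
  have c2 := mul_le_mul_of_nonneg_right b2 (sq_nonneg z)
  have c3 := mul_le_mul_of_nonneg_right b3 (sq_nonneg z')
  have c4 := mul_le_mul_of_nonneg_left hhardy (show 0 ≤ 1 / (4 * α) by positivity)
  have c5 : 5 / 4 * C * h ^ 2 ≤ s ^ 3 / 8 / (4 * α) := by
    have d1 : s * (40 * α * C) ≤ 1 := by
      rw [lt_div_iff₀ (by positivity)] at gsm
      exact gsm.le
    rw [← hsq, div_div, le_div_iff₀ (by positivity)]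
    have d2 := mul_le_mul_of_nonneg_left d1 (pow_pos hs 3).le
    linarith
  have c6 := mul_le_mul_of_nonneg_right c5 (sq_nonneg z)
  have c7 : 1 / (4 * α) * ((t + t ^ 3 / 8) * z' ^ 2 - s * z ^ 2) =
      (t + t ^ 3 / 8) / (4 * α) * z' ^ 2 - s / (4 * α) * z ^ 2 := by
    field_simp
  have c8 : (s + s ^ 3 / 8) / (4 * α) = s / (4 * α) + s ^ 3 / 8 / (4 * α) := add_div _ _ _
  rw [c7] at c4
  rw [e, c8]
  linarith

/-- On a space of finite codimension, `⟨K_α x, x⟩ ≥ (α / 2) ‖K_α x‖²`. -/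
theorem exists_codim_le_quadForm {α : ℝ} (hα : 0 < α) : ∃ k₀ : ℕ, ∀ x : EllTwo,
    (∀ k ≤ k₀, coord (hardyOp α x) k = 0) →
      α / 2 * ‖hardyOp α x‖ ^ 2 ≤ quadForm (hardyOp α) x := by
  obtain ⟨k₀, hk₀⟩ := exists_storage_step hα
  refine ⟨k₀, fun x hx => ?_⟩
  have hC := expansionConst_pos hα
  have key : ∀ φ : ℂ →L[ℝ] ℝ, ∀ M ≥ k₀,
      α / 2 * ∑ k ∈ Finset.range M, φ (coord (hardyOp α x) k) ^ 2 -
        boundaryCoeff α M * scaledImage α x φ M ^ 2 ≤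
      ∑ k ∈ Finset.range M, (1 - stepRatio α k ^ 2) *
        lowerSum α (scaled fun i => φ (coord x i)) k ^ 2 := by
    intro φ M hM
    induction M, hM using Nat.le_induction with
    | base =>
      have h1 : scaledImage α x φ k₀ = 0 := by rw [scaledImage, hx k₀ le_rfl, map_zero, mul_zero]
      rw [h1, Finset.sum_eq_zero fun k hk => by
        rw [hx k (Finset.mem_range.1 hk).le, map_zero, zero_pow two_ne_zero]]
      have h2 := Finset.sum_nonneg fun k (_ : k ∈ Finset.range k₀) =>
        mul_nonneg (one_sub_stepRatio_sq_pos hα k).le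
          (sq_nonneg (lowerSum α (scaled fun i => φ (coord x i)) k))
      simpa using h2
    | succ M hM ih =>
      have h1 := hk₀ M hM _ _ _ (scaledImage_sub hα x φ M)
      rw [scaledImage_sq] at h1
      rw [Finset.sum_range_succ, Finset.sum_range_succ]
      linarith
  have hsq : ∀ w : ℂ, ‖w‖ ^ 2 = Complex.reCLM w ^ 2 + Complex.imCLM w ^ 2 := fun w => by
    rw [← Complex.normSq_eq_norm_sq, Complex.normSq_apply]
    simp [sq]
  have hg : ∀ M : ℕ, 1 / ((M : ℝ) + 1) * (((M : ℝ) + 1) * ‖coord (hardyOp α x) M‖ ^ 2) =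
      ‖coord (hardyOp α x) M‖ ^ 2 := fun M => by field_simp
  have hgs : ∀ M : ℕ, ((M : ℝ) + 1) * ‖coord (hardyOp α x) M‖ ^ 2 =
      scaledImage α x Complex.reCLM M ^ 2 + scaledImage α x Complex.imCLM M ^ 2 := fun M => by
    rw [hsq, scaledImage, scaledImage, mul_pow, mul_pow, Real.sq_sqrt (by positivity)]
    ring
  refine le_of_tendsto' ((hasSum_coord_sq (hardyOp α x)).tendsto_sum_nat.const_mul (α / 2))
    fun m => le_of_forall_pos_le_add fun ε hε => ?_
  -- The lower boundary term vanishes because (Kx) is zero up to k₀. The upper one need not tend to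
  -- 0, but it is small at arbitrarily large M by the harmonic series argument.
  obtain ⟨M, hM, hMε⟩ := exists_lt_of_summable
    (g := fun M => ((M : ℝ) + 1) * ‖coord (hardyOp α x) M‖ ^ 2)
    ((hasSum_coord_sq (hardyOp α x)).summable.congr fun M => (hg M).symm)
    (show 0 < ε / (1 / 2 + expansionConst α) by positivity) (max m k₀)
  have h1 := key Complex.reCLM M (by omega)
  have h2 := key Complex.imCLM M (by omega)
  have h3 := sum_lowerSum_le_quadForm hα x M
  have h4 : ∑ k ∈ Finset.range m, ‖coord (hardyOp α x) k‖ ^ 2 ≤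
      ∑ k ∈ Finset.range M, ‖coord (hardyOp α x) k‖ ^ 2 :=
    Finset.sum_le_sum_of_subset_of_nonneg (Finset.range_mono (by omega))
      fun _ _ _ => by positivity
  have h5 : ∑ k ∈ Finset.range M, ‖coord (hardyOp α x) k‖ ^ 2 =
      ∑ k ∈ Finset.range M, Complex.reCLM (coord (hardyOp α x) k) ^ 2 +
        ∑ k ∈ Finset.range M, Complex.imCLM (coord (hardyOp α x) k) ^ 2 := by
    simp only [hsq, Finset.sum_add_distrib]
  have h6 : boundaryCoeff α M * (((M : ℝ) + 1) * ‖coord (hardyOp α x) M‖ ^ 2) ≤ ε := by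
    rw [lt_div_iff₀ (by positivity)] at hMε
    have := mul_le_mul_of_nonneg_right (boundaryCoeff_le hα M)
      (show 0 ≤ ((M : ℝ) + 1) * ‖coord (hardyOp α x) M‖ ^ 2 by positivity)
    linarith
  have h7 := mul_le_mul_of_nonneg_left h4 (show 0 ≤ α / 2 by positivity)
  rw [hgs] at h6
  rw [h5] at h7
  simp only [Complex.reCLM_apply, Complex.imCLM_apply] at h1 h2 h6 h7
  linarith

/-- The linear functionals `x ↦ x(n)`, `n ≤ N`. -/
noncomputable def coordMap (N : ℕ) : EllTwo →ₗ[ℂ] (Fin N → ℂ) where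
  toFun x i := coord x i
  map_add' _ _ := rfl
  map_smul' _ _ := rfl

theorem exists_mem_ne_zero_of_lt_finrank {N : ℕ} (V : Submodule ℂ EllTwo) [FiniteDimensional ℂ V]
    (hV : N < Module.finrank ℂ V) (T : EllTwo →ₗ[ℂ] EllTwo) :
    ∃ x ∈ V, x ≠ 0 ∧ ∀ i < N, coord (T x) i = 0 := by
  have hker : (coordMap N ∘ₗ T ∘ₗ V.subtype).ker ≠ ⊥ :=
    LinearMap.ker_ne_bot_of_finrank_lt (by simpa using hV)
  obtain ⟨x, hx, hx0⟩ := (Submodule.ne_bot_iff _).1 hker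
  exact ⟨x, x.2, by simpa using hx0, fun i hi => congrFun (LinearMap.mem_ker.1 hx) ⟨i, hi⟩⟩

/-- Every eigenvalue satisfies μ > 2/α, so (α/2)μ² > μ and (α/2)‖Kx‖² > ⟨Kx, x⟩ on nonzero
combinations of eigenvectors. A span of dimension k₀ + 2 would contain such an x with the first k₀ +
1 coordinates of Kx zero, against `exists_codim_le_quadForm`. -/
theorem finite_eigenvalueSet {α : ℝ} (hα : 0 < α) : (eigenvalueSet (hardyOp α)).Finite := by
  by_contra hinf
  obtain ⟨k₀, hk₀⟩ := exists_codim_le_quadForm hα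
  obtain ⟨S, hS, hScard⟩ := Set.Infinite.exists_subset_card_eq hinf (k₀ + 2)
  obtain ⟨V, hVfd, hVc, hV⟩ := exists_eigenspan (isSymmetric_hardyOp hα) S hS
  obtain ⟨x, hxV, hx0, hx⟩ := exists_mem_ne_zero_of_lt_finrank V
    (show k₀ + 1 < Module.finrank ℂ V by omega) (hardyOp α : EllTwo →ₗ[ℂ] EllTwo)
  have h := hk₀ x fun k hk => hx k (by omega)
  obtain ⟨a, ha, h1, h2, h3⟩ := hV x hxV
  rw [h2, h3, Finset.mul_sum, ← sub_nonpos, ← Finset.sum_sub_distrib] at h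
  have hlt : ∀ μ : S, 0 < α / 2 * (μ : ℝ) ^ 2 - μ := fun μ => by
    have h4 := two_div_lt_of_mem_eigenvalueSet hα (hS μ.2)
    rw [div_lt_iff₀ hα] at h4
    have h5 : (0 : ℝ) < μ := by
      by_contra! h6
      nlinarith
    nlinarith
  have hterm : ∀ μ : S, α / 2 * ((μ : ℝ) ^ 2 * a μ) - μ * a μ =
      (α / 2 * (μ : ℝ) ^ 2 - μ) * a μ := fun μ => by ring
  simp only [hterm] at h
  have hzero := (Finset.sum_eq_zero_iff_of_nonneg fun μ _ =>
    mul_nonneg (hlt μ).le (ha μ)).1 (h.antisymm (Finset.sum_nonneg fun μ _ =>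
      mul_nonneg (hlt μ).le (ha μ)))
  have ha0 : ∀ μ, a μ = 0 := fun μ =>
    (mul_eq_zero.1 (hzero μ (Finset.mem_univ μ))).resolve_left (hlt μ).ne'
  rw [Finset.sum_eq_zero fun μ _ => ha0 μ] at h1
  exact hx0 (by simpa using h1)

/-! ### The enumeration of the eigenvalues -/

section Sorting

variable {S : Finset ℝ} {j : ℕ}

theorem sort_getD_eq (hj : 1 ≤ j) (hjS : j ≤ S.card) :
    (S.sort (fun a b => b ≤ a)).getD (j - 1) 0 =
      (S.sort (fun a b => b ≤ a))[j - 1]'(by rw [Finset.length_sort]; omega) :=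
  List.getD_eq_getElem _ _ _

theorem sort_getElem_le {i k : ℕ} (hik : i ≤ k)
    (hk : k < (S.sort (fun a b => b ≤ a)).length) :
    (S.sort (fun a b => b ≤ a))[k] ≤ (S.sort (fun a b => b ≤ a))[i] := by
  rcases hik.eq_or_lt with rfl | hlt
  · exact le_rfl
  · exact List.pairwise_iff_getElem.1 (Finset.pairwise_sort S (fun a b => b ≤ a)) i k
      (hlt.trans hk) hk hlt

theorem exists_subset_ge_sort_getD (hj : 1 ≤ j) (hjS : j ≤ S.card) :
    ∃ R ⊆ S, R.card = j ∧ ∀ μ ∈ R, (S.sort (fun a b => b ≤ a)).getD (j - 1) 0 ≤ μ := by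
  set l := S.sort (fun a b => b ≤ a) with hl
  have hlen : l.length = S.card := Finset.length_sort _
  refine ⟨(l.take j).toFinset, fun μ hμ => ?_, ?_, fun μ hμ => ?_⟩
  · rw [List.mem_toFinset] at hμ
    exact (Finset.mem_sort _).1 (List.mem_of_mem_take hμ)
  · rw [List.toFinset_card_of_nodup ((Finset.sort_nodup S _).sublist (List.take_sublist _ _)),
      List.length_take, hlen, min_eq_left hjS]
  · rw [List.mem_toFinset] at hμ
    obtain ⟨i, hi, rfl⟩ := List.getElem_of_mem hμ
    rw [List.length_take] at hi
    rw [List.getElem_take, sort_getD_eq hj hjS]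
    exact sort_getElem_le (by omega) _

/-- If the j-th largest element were at most b, the elements above b would all be among the first j
- 1. -/
theorem lt_sort_getD (hj : 1 ≤ j) {b : ℝ} (hb : j ≤ (S.filter (b < ·)).card) :
    b < (S.sort (fun a b => b ≤ a)).getD (j - 1) 0 := by
  have hjS : j ≤ S.card := hb.trans (Finset.card_filter_le _ _)
  by_contra! hle
  have hsub : S.filter (b < ·) ⊆ ((S.sort (fun a b => b ≤ a)).take (j - 1)).toFinset := by
    intro μ hμ
    obtain ⟨hμS, hbμ⟩ := Finset.mem_filter.1 hμ
    obtain ⟨i, hi, rfl⟩ := List.getElem_of_mem ((Finset.mem_sort (fun a b => b ≤ a)).2 hμS)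
    have hij : i < j - 1 := by
      by_contra! hji
      have := sort_getElem_le hji hi
      rw [sort_getD_eq hj hjS] at hle
      linarith
    rw [List.mem_toFinset, List.mem_take_iff_getElem]
    exact ⟨i, by omega, rfl⟩
  have h1 := (Finset.card_le_card hsub).trans (List.toFinset_card_le _)
  rw [List.length_take] at h1
  omega

end Sorting

section Enumeration

variable {T : EllTwo →L[ℂ] EllTwo} {j : ℕ}

theorem exists_eigenvalues_ge_nth (hfin : (eigenvalueSet T).Finite) (hj : 1 ≤ j)
    (hjT : j ≤ eigenvalueCount T) :
    ∃ R : Finset ℝ, ↑R ⊆ eigenvalueSet T ∧ R.card = j ∧ ∀ μ ∈ R, nthEigenvalue T j ≤ μ := by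
  rw [eigenvalueCount, Set.ncard_eq_toFinset_card _ hfin] at hjT
  obtain ⟨R, hR, hRc, h⟩ := exists_subset_ge_sort_getD hj hjT
  refine ⟨R, fun μ hμ => hfin.mem_toFinset.1 (hR hμ), hRc, fun μ hμ => ?_⟩
  rw [nthEigenvalue, dif_pos ⟨hfin, hj⟩]
  exact h μ hμ

theorem lt_nthEigenvalue (hfin : (eigenvalueSet T).Finite) (hj : 1 ≤ j) {b : ℝ}
    (hb : j ≤ (eigenvalueSet T ∩ Ioi b).ncard) : b < nthEigenvalue T j := by
  rw [nthEigenvalue, dif_pos ⟨hfin, hj⟩]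
  refine lt_sort_getD hj (hb.trans (le_of_eq ?_))
  rw [Set.ncard_eq_toFinset_card _ (hfin.inter_of_left _)]
  congr 1
  ext μ
  simp

theorem lt_nthEigenvalue_of_forall_lt (hfin : (eigenvalueSet T).Finite) (hj : 1 ≤ j)
    (hjT : j ≤ eigenvalueCount T) {c : ℝ} (hc : ∀ μ ∈ eigenvalueSet T, c < μ) :
    c < nthEigenvalue T j := by
  refine lt_nthEigenvalue hfin hj ?_
  have h : eigenvalueSet T ∩ Ioi c = eigenvalueSet T := Set.inter_eq_left.2 hc
  rwa [h]

end Enumeration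

/-! ### Rescaling -/

theorem eigenspace_smul {s : ℝ} (hs : s ≠ 0) (T : EllTwo →L[ℂ] EllTwo) (μ : ℝ) :
    Module.End.eigenspace (((s : ℂ) • T : EllTwo →L[ℂ] EllTwo) : Module.End ℂ EllTwo)
        ((s * μ : ℝ) : ℂ) =
      Module.End.eigenspace (T : Module.End ℂ EllTwo) (μ : ℂ) := by
  ext x
  rw [Module.End.mem_eigenspace_iff, Module.End.mem_eigenspace_iff]
  change (s : ℂ) • T x = ((s * μ : ℝ) : ℂ) • x ↔ T x = (μ : ℂ) • x
  rw [Complex.ofReal_mul, mul_smul]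
  exact smul_right_inj (Complex.ofReal_ne_zero.2 hs)

theorem eigenvalueSet_smul {s : ℝ} (hs : s ≠ 0) (T : EllTwo →L[ℂ] EllTwo) :
    eigenvalueSet ((s : ℂ) • T) = (s * ·) '' eigenvalueSet T := by
  have h : ∀ μ : ℝ, s * μ ∈ eigenvalueSet ((s : ℂ) • T) ↔ μ ∈ eigenvalueSet T := fun μ => by
    simp only [eigenvalueSet, Set.mem_ofPred_eq, Module.End.hasEigenvalue_iff]
    rw [eigenspace_smul hs]
  ext ν
  constructor
  · intro hν
    refine ⟨s⁻¹ * ν, (h _).1 ?_, ?_⟩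
    · rwa [mul_inv_cancel_left₀ hs]
    · exact mul_inv_cancel_left₀ hs ν
  · rintro ⟨μ, hμ, rfl⟩
    exact (h μ).2 hμ

theorem eigenvalueCount_smul {s : ℝ} (hs : s ≠ 0) (T : EllTwo →L[ℂ] EllTwo) :
    eigenvalueCount ((s : ℂ) • T) = eigenvalueCount T := by
  rw [eigenvalueCount, eigenvalueSet_smul hs]
  exact Set.ncard_image_of_injective _ (mul_right_injective₀ hs)

theorem isSymmetric_smul_hardyOp {α : ℝ} (hα : 0 < α) :
    (((α : ℂ) • hardyOp α : EllTwo →L[ℂ] EllTwo) : EllTwo →ₗ[ℂ] EllTwo).IsSymmetric :=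
  fun x y => by
    have h : inner ℂ (hardyOp α x) y = inner ℂ x (hardyOp α y) := isSymmetric_hardyOp hα x y
    change inner ℂ ((α : ℂ) • hardyOp α x) y = inner ℂ x ((α : ℂ) • hardyOp α y)
    rw [inner_smul_left, inner_smul_right, Complex.conj_ofReal, h]

theorem finite_eigenvalueSet_smul {α : ℝ} (hα : 0 < α) :
    (eigenvalueSet ((α : ℂ) • hardyOp α)).Finite := by
  rw [eigenvalueSet_smul hα.ne']
  exact (finite_eigenvalueSet hα).image _

theorem two_lt_of_mem_eigenvalueSet_smul {α : ℝ} (hα : 0 < α) :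
    ∀ μ ∈ eigenvalueSet ((α : ℂ) • hardyOp α), 2 < μ := by
  rw [eigenvalueSet_smul hα.ne']
  rintro _ ⟨μ, hμ, rfl⟩
  have := two_div_lt_of_mem_eigenvalueSet hα hμ
  rwa [div_lt_iff₀' hα] at this

/-- The form of `α K_α` increases strictly with `α`, and so do the counting functions of its
eigenvalues above any level `b ≥ 2`. -/
theorem le_ncard_of_lt {α β : ℝ} (hα : 0 < α) (hβ : α < β) {R : Finset ℝ}
    (hR : ↑R ⊆ eigenvalueSet ((α : ℂ) • hardyOp α)) {b : ℝ} (hb : 2 ≤ b)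
    (hRb : ∀ μ ∈ R, b ≤ μ) :
    R.card ≤ (eigenvalueSet ((β : ℂ) • hardyOp β) ∩ Ioi b).ncard := by
  have hβ0 := hα.trans hβ
  obtain ⟨V, hVfd, hVc, hV⟩ := exists_eigenspan_quadForm_ge (isSymmetric_smul_hardyOp hα) R hR hRb
  rw [← hVc]
  refine le_ncard_eigenvalues (isSymmetric_smul_hardyOp hβ0)
    ((essentiallyBounded_hardyOp hβ0).smul hβ0) (finite_eigenvalueSet_smul hβ0) ?_
    (by rwa [mul_div_cancel₀ _ hβ0.ne']) V
    fun x hx hx0 => (hV x hx).trans_lt (quadForm_hardyOp_strictMono hα hβ hx0)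
  rw [eigenvalueSet_smul hβ0.ne']
  rintro _ ⟨μ, hμ, rfl⟩
  rw [eigenspace_smul hβ0.ne']
  exact finrank_eigenspace_hardyOp hβ0 hμ

/-- All eigenvalues of αK_α exceed 2, so the comparison at the level b = 2 accounts for every one of
them. -/
theorem eigenvalueCount_mono {α β : ℝ} (hα : 0 < α) (hβ : α ≤ β) :
    eigenvalueCount (hardyOp α) ≤ eigenvalueCount (hardyOp β) := by
  rcases hβ.eq_or_lt with rfl | hlt
  · exact le_rfl
  rw [← eigenvalueCount_smul hα.ne' (hardyOp α),
    ← eigenvalueCount_smul (hα.trans hlt).ne' (hardyOp β), eigenvalueCount,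
    Set.ncard_eq_toFinset_card _ (finite_eigenvalueSet_smul hα)]
  refine (le_ncard_of_lt hα hlt (R := (finite_eigenvalueSet_smul hα).toFinset)
    (by rw [Set.Finite.coe_toFinset]) le_rfl fun μ hμ => ?_).trans
    (Set.ncard_le_ncard Set.inter_subset_left (finite_eigenvalueSet_smul (hα.trans hlt)))
  exact (two_lt_of_mem_eigenvalueSet_smul hα μ ((Set.Finite.mem_toFinset _).1 hμ)).le

/-- The comparison is made at the level b = λ_j(αK_α), which is above 2: the j largest eigenvalues
of αK_α force j eigenvalues of βK_β strictly above b. -/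
theorem strictMonoOn_nthEigenvalue {j : ℕ} (hj : 1 ≤ j) :
    StrictMonoOn (fun α : ℝ => nthEigenvalue ((α : ℂ) • hardyOp α) j)
      {α : ℝ | 0 < α ∧ j ≤ eigenvalueCount (hardyOp α)} := by
  rintro α ⟨hα, hjα⟩ β ⟨hβ0, -⟩ hβ
  rw [← eigenvalueCount_smul hα.ne'] at hjα
  obtain ⟨R, hR, hRc, hRb⟩ := exists_eigenvalues_ge_nth (finite_eigenvalueSet_smul hα) hj hjα
  refine lt_nthEigenvalue (finite_eigenvalueSet_smul hβ0) hj ?_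
  rw [← hRc] at hRb ⊢
  exact le_ncard_of_lt hα hβ hR (lt_nthEigenvalue_of_forall_lt (finite_eigenvalueSet_smul hα)
    (hRc ▸ hj) (hRc ▸ hjα) (two_lt_of_mem_eigenvalueSet_smul hα)).le hRb

/-! ### Large `α` -/

/-- The trial space is spanned by the first j basis vectors, where the diagonal part of the form is
at least 1/j. -/
theorem le_ncard_of_lt_one_div {α : ℝ} (hα : 0 < α) {j : ℕ} {b : ℝ} (hj : 1 ≤ j)
    (hb : 2 / α ≤ b) (hbj : b < 1 / (j : ℝ) - 2 / α) :
    j ≤ (eigenvalueSet (hardyOp α) ∩ Ioi b).ncard := by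
  let e : Fin j → EllTwo := fun i => lp.single 2 (i : ℕ).succPNat (1 : ℂ)
  have hcoord : ∀ (i : Fin j) (k : ℕ), coord (e i) k = if k = i then 1 else 0 := fun i k => by
    simp only [coord, e, lp.coeFn_single, Pi.single_apply, Nat.succPNat_injective.eq_iff]
  have hsum : ∀ (l : Fin j → ℂ) (k : ℕ), coord (∑ i, l i • e i) k =
      ∑ i, l i * coord (e i) k := fun l k => by
    simp only [coord, lp.coeFn_sum, Finset.sum_apply, lp.coeFn_smul, Pi.smul_apply, smul_eq_mul]
  have hli : LinearIndependent ℂ e := by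
    rw [Fintype.linearIndependent_iff]
    intro l hl i
    have h := hsum l i
    rw [hl] at h
    simp only [hcoord, Fin.val_inj, mul_ite, mul_one, mul_zero, Finset.sum_ite_eq,
      Finset.mem_univ, if_true] at h
    exact h.symm
  have hfd : FiniteDimensional ℂ (Submodule.span ℂ (Set.range e)) :=
    FiniteDimensional.span_of_finite ℂ (Set.finite_range e)
  have hrank : Module.finrank ℂ (Submodule.span ℂ (Set.range e)) = j := by
    rw [finrank_span_eq_card hli, Fintype.card_fin]
  have h := le_ncard_eigenvalues (isSymmetric_hardyOp hα) (essentiallyBounded_hardyOp hα)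
    (finite_eigenvalueSet hα) (fun μ hμ => finrank_eigenspace_hardyOp hα hμ) hb
    (Submodule.span ℂ (Set.range e)) fun x hx hx0 => by
      obtain ⟨l, rfl⟩ := (Submodule.mem_span_range_iff_exists_fun ℂ).1 hx
      refine lt_of_lt_of_le ?_ (le_quadForm_hardyOp hα (N := j - 1) fun k hk => ?_)
      · have hn : 0 < ‖∑ i, l i • e i‖ := norm_pos_iff.2 hx0
        have hj' : ((j - 1 : ℕ) : ℝ) + 1 = j := by
          rw [Nat.cast_sub hj]; push_cast; ring
        rw [hj']
        gcongr
      · rw [hsum]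
        refine Finset.sum_eq_zero fun i _ => ?_
        rw [hcoord, if_neg (by have := i.2; omega), mul_zero]
  rwa [hrank] at h

/-- The condition 4j < α is exactly what places the level 2/α below 1/j - 2/α. -/
theorem le_eigenvalueCount_of_lt {α : ℝ} {j : ℕ} (hj : 1 ≤ j) (hα : 4 * (j : ℝ) < α) :
    j ≤ eigenvalueCount (hardyOp α) := by
  have hj0 : (0 : ℝ) < j := by exact_mod_cast hj
  have hα0 : 0 < α := by linarith
  refine (le_ncard_of_lt_one_div hα0 hj le_rfl ?_).trans
    (Set.ncard_le_ncard Set.inter_subset_left (finite_eigenvalueSet hα0))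
  have h : 4 / α < 1 / (j : ℝ) := by rw [div_lt_div_iff₀ hα0 hj0]; linarith
  have h2 : 4 / α = 2 / α + 2 / α := by ring
  linarith

theorem abs_nthEigenvalue_sub_le {α : ℝ} {j : ℕ} (hj : 1 ≤ j) (hα : 4 * (j : ℝ) < α) :
    |nthEigenvalue (hardyOp α) j - 1 / (j : ℝ)| ≤ 2 / α := by
  have hj0 : (0 : ℝ) < j := by exact_mod_cast hj
  have hα0 : 0 < α := by linarith
  have h4 : 4 / α < 1 / (j : ℝ) := by rw [div_lt_div_iff₀ hα0 hj0]; linarith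
  have h2 : 4 / α = 2 / α + 2 / α := by ring
  rw [abs_sub_le_iff]
  constructor
  · obtain ⟨R, hR, hRc, hRb⟩ := exists_eigenvalues_ge_nth (finite_eigenvalueSet hα0) hj
      (le_eigenvalueCount_of_lt hj hα)
    obtain ⟨V, hVfd, hVc, hV⟩ := exists_eigenspan_quadForm_ge (isSymmetric_hardyOp hα0) R hR hRb
    -- The span of eigenvectors for the j largest eigenvalues meets the vectors vanishing in the
    -- first j - 1 coordinates, where the form is at most 1/j + 2/α.
    obtain ⟨x, hxV, hx0, hx⟩ := exists_mem_ne_zero_of_lt_finrank V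
      (show j - 1 < Module.finrank ℂ V by omega) LinearMap.id
    have h := (hV x hxV).trans (quadForm_hardyOp_le hα0 hx)
    have hj' : ((j - 1 : ℕ) : ℝ) + 1 = j := by
      rw [Nat.cast_sub hj]; push_cast; ring
    rw [hj'] at h
    have := le_of_mul_le_mul_right h (pow_pos (norm_pos_iff.2 hx0) 2)
    linarith
  · by_contra! hlt
    -- The level b must exceed the supposed λ_j and also 2/α, so that the counting of eigenvalues
    -- above b applies.
    obtain ⟨b, hb1, hb2⟩ := exists_between
      (max_lt (show nthEigenvalue (hardyOp α) j < 1 / (j : ℝ) - 2 / α by linarith)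
        (show 2 / α < 1 / (j : ℝ) - 2 / α by linarith))
    rw [max_lt_iff] at hb1
    have := lt_nthEigenvalue (finite_eigenvalueSet hα0) hj
      (le_ncard_of_lt_one_div hα0 hj hb1.2.le hb2)
    linarith

end HardyMatrix

theorem theoremB :
    -- the eigenvalues of `K_α` are real, simple and finite in number
    (∀ α : ℝ, 0 < α →
      (∀ μ : ℂ, Module.End.HasEigenvalue (hardyOp α : Module.End ℂ EllTwo) μ →
        μ.im = 0 ∧
          Module.finrank ℂ (Module.End.eigenspace (hardyOp α : Module.End ℂ EllTwo) μ) = 1) ∧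
      (eigenvalueSet (hardyOp α)).Finite) ∧
    -- (i)
    (∀ j : ℕ, 1 ≤ j →
      StrictMonoOn (fun α : ℝ => nthEigenvalue ((α : ℂ) • hardyOp α) j)
        {α : ℝ | 0 < α ∧ j ≤ eigenvalueCount (hardyOp α)}) ∧
    -- (ii)
    (MonotoneOn (fun α : ℝ => eigenvalueCount (hardyOp α)) (Ioi 0) ∧
      ¬ BddAbove ((fun α : ℝ => eigenvalueCount (hardyOp α)) '' Ioi 0)) ∧
    -- (iii)
    (∀ j : ℕ, 1 ≤ j →
      (∀ᶠ α : ℝ in atTop, j ≤ eigenvalueCount (hardyOp α)) ∧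
      (fun α : ℝ => nthEigenvalue (hardyOp α) j - 1 / (j : ℝ)) =O[atTop]
        (fun α : ℝ => α⁻¹)) := by
  refine ⟨fun α hα => ⟨fun μ hμ => ?_, HardyMatrix.finite_eigenvalueSet hα⟩,
    fun j hj => HardyMatrix.strictMonoOn_nthEigenvalue hj,
    ⟨fun α hα β _ hβ => HardyMatrix.eigenvalueCount_mono hα hβ, ?_⟩, fun j hj => ⟨?_, ?_⟩⟩
  · have him := HardyMatrix.im_eq_zero_of_hasEigenvalue hα hμ
    obtain ⟨r, rfl⟩ : ∃ r : ℝ, (r : ℂ) = μ := ⟨μ.re, Complex.ext rfl him.symm⟩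
    exact ⟨him, HardyMatrix.finrank_eigenspace_hardyOp hα hμ⟩
  · rintro ⟨B, hB⟩
    -- At α = 4(B+1) + 1 there are at least B + 1 eigenvalues.
    have hpos : (0 : ℝ) < 4 * ((B + 1 : ℕ) : ℝ) + 1 := by positivity
    have h1 := hB ⟨_, hpos, rfl⟩
    have h2 := HardyMatrix.le_eigenvalueCount_of_lt (j := B + 1) (by omega) (lt_add_one _)
    exact absurd (h2.trans h1) (by omega)
  · filter_upwards [eventually_gt_atTop (4 * (j : ℝ))] with α hα
    exact HardyMatrix.le_eigenvalueCount_of_lt hj hα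
  · refine IsBigO.of_bound 2 ?_
    filter_upwards [eventually_gt_atTop (4 * (j : ℝ)), eventually_gt_atTop 0] with α hα hα0
    rw [Real.norm_eq_abs, norm_inv, Real.norm_of_nonneg hα0.le, ← div_eq_mul_inv]
    exact HardyMatrix.abs_nthEigenvalue_sub_le hj hα
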